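/- Let $n\ge 0$ and let $X_1,\dots,X_n$ be real random variables with any exchangeable joint distribution. Put $S_0=0$, $S_j=\sum_{\ell=1}^j X_\ell$ and $S^{[0,n]}=\{(j,S_j):0\le j\le n\}$. Let $\Sigma_m$ denote the set of permutations of $[m]=\{1,\dots,m\}$. For a partition $(n_1,\dots,n_k)$ of $n$ with $n_1\ge\dots\ge n_k>0$ and for $\tau\in\Sigma_k$, write $b_i^\tau=n_{\tau(1)}+\dots+n_{\tau(i)}$ $(0\le i\le k)$, and let $\Sigma^{\tau}_{(n_1,\dots,n_k)}$ be the set of those $\sigma\in\Sigma_n$ for which there is $(r_1,\dots,r_k)\in\mathbb Z^k$ with $$\sigma\bigl(b^\tau_{i-1}+j\bigr)=\sum_{l=1}^{\tau(i)-1}n_l+\bigl((j-1+r_i)\bmod n_{\tau(i)}\bigr)+1\qquad(1\le j\le n_{\tau(i)},\ 1\le i\le k).$$ That is, $\sigma$ puts the consecutive blocks of $[n]$ of lengths $n_1,\dots,n_k$ in the order $\tau(1),\dots,\tau(k)$ and shifts each block cyclically. For $x=(x_1,\dots,x_n)\in\mathbb R^n$ let $B(n_1,\dots,n_k;x)$ be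 the set of all $\sigma\in\Sigma_n$ for which there exists $\tau\in\Sigma_k$ with $\sigma\in\Sigma^\tau_{(n_1,\dots,n_k)}$ such that $$\Delta_i:=\frac1{n_{\tau(i)}}\sum_{\ell=b^\tau_{i-1}+1}^{b^\tau_i}x_{\sigma(\ell)}\quad\text{is non-increasing in } i,$$ $$\frac1m\sum_{\ell=b^\tau_{i-1}+1}^{b^\tau_{i-1}+m}x_{\sigma(\ell)}\le\Delta_i\qquad\text{for } 1\le m\le n_{\tau(i)},\ 1\le i\le k.$$ Then $B(n_1,\dots,n_k;x)$ is never empty. Let $(L_1,\dots,L_K)$ be independent of $(X_1,\dots,X_n)$ and distributed like the lengths of the cycles of a uniform random permutation of $[n]$, arranged in non-increasing order. Conditionally given $X=(X_1,\dots,X_n)$ and $(L_1,\dots,L_K)$, let $\rho$ be a uniform random element of $B=B(L_1,\dots,L_K;X)$. Put $S^\rho_j=\sum_{\ell=1}^jX_{\rho(\ell)}$ for $0\le j\le n$ and $S_\rho^{[0,n]}=\{(j,S^\rho_j):0\le j\le n\}$. Then: 1. $S_\rho^{[0,n]}$ has the same distribution as $S^{[0,n]}$. 2. Almost surely there is $\tau$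 witnessing $\rho\in B$ such that the concave majorant of $S_\rho^{[0,n]}$ (the least concave function $C$ on $[0,n]$ with $C(j)\ge S^\rho_j$ for $0\le j\le n$) is obtained by joining successive points $(b_i^\tau,S^\rho_{b_i^\tau})$, $0\le i\le k$, by line segments; thus the $i$th segment of the concave majorant has length $n_{\tau(i)}$ and slope $\Delta_i$. (Here $k=K$ and $(n_1,\dots,n_k)=(L_1,\dots,L_K)$.) -/

import Mathlib

open MeasureTheory ProbabilityTheory

noncomputable section

namespace CyclicRearrangement

/-- Partitions of `n` form a finite set and carry the discrete σ-algebra. -/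
instance instMeasurableSpacePartition (n : ℕ) : MeasurableSpace (Nat.Partition n) := ⊤

/-- Permutations of `Fin n` form a finite set and carry the discrete σ-algebra. -/
instance instMeasurableSpacePerm (n : ℕ) : MeasurableSpace (Equiv.Perm (Fin n)) := ⊤

/-- The walk with increments `y 0, …, y (n-1)`: `walk y j` is the sum of the first `j` of them. -/
def walk {n : ℕ} (y : Fin n → ℝ) (j : ℕ) : ℝ :=
  ∑ a : Fin n with a.val < j, y a

/-- The mean of the `m` consecutive increments of `y` that come after the first `s` ones. -/
def segMean {n : ℕ} (y : Fin n → ℝ) (s m : ℕ) : ℝ :=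
  (∑ a : Fin n with s ≤ a.val ∧ a.val < s + m, y a) / m

section Blocks

variable {n : ℕ}

/-- The parts `n₁ ≥ n₂ ≥ … ≥ n_k` of a partition, in non-increasing order. -/
def lengths (p : Nat.Partition n) : List ℕ :=
  p.parts.sort (fun a b => b ≤ a)

/-- The number `k` of parts. -/
def numBlocks (p : Nat.Partition n) : ℕ := (lengths p).length

/-- The length of the `i`-th block. -/
def blockLen (p : Nat.Partition n) (i : Fin (numBlocks p)) : ℕ := (lengths p).get i

/-- The number of positions before the `i`-th block, when the blocks are laid out in the order
`τ 0, τ 1, …, τ (k-1)`. -/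
def start (p : Nat.Partition n) (τ : Equiv.Perm (Fin (numBlocks p)))
    (i : Fin (numBlocks p)) : ℕ :=
  ∑ l : Fin (numBlocks p) with l < i, blockLen p (τ l)

/-- `σ` lays out the blocks of `{0, …, n-1}` of lengths `n₁, …, n_k` in the order given by `τ`, and
shifts each of them cyclically (by `r i` for the block in the `i`-th place). -/
def IsArrangement (p : Nat.Partition n) (τ : Equiv.Perm (Fin (numBlocks p)))
    (σ : Equiv.Perm (Fin n)) : Prop :=
  ∃ r : Fin (numBlocks p) → ℤ, ∀ (i : Fin (numBlocks p)) (j : ℕ), j < blockLen p (τ i) →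
    ∀ a : Fin n, a.val = start p τ i + j →
      ((σ a).val : ℤ) = (start p 1 (τ i) : ℤ) + ((j : ℤ) + r i) % (blockLen p (τ i) : ℤ)

/-- `σ` arranges the blocks in the order `τ` with cyclic shifts, and for the increments
`x (σ 0), x (σ 1), …` the block means are non-increasing along the walk and the walk stays, within
each block, below the chord joining its values at the ends of the block. -/
def IsAdmissible (p : Nat.Partition n) (x : Fin n → ℝ) (τ : Equiv.Perm (Fin (numBlocks p)))
    (σ : Equiv.Perm (Fin n)) : Prop :=
  IsArrangement p τ σ ∧
  Antitone (fun i => segMean (x ∘ σ) (start p τ i) (blockLen p (τ i))) ∧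
  ∀ (i : Fin (numBlocks p)) (m : ℕ), 1 ≤ m → m ≤ blockLen p (τ i) →
    segMean (x ∘ σ) (start p τ i) m ≤ segMean (x ∘ σ) (start p τ i) (blockLen p (τ i))

open Classical in
/-- The set `B` of all admissible rearrangements. -/
def admissible (p : Nat.Partition n) (x : Fin n → ℝ) : Finset (Equiv.Perm (Fin n)) :=
  {σ | ∃ τ, IsAdmissible p x τ σ}

end Blocks

/-- `C` is, on `[0, n]`, the least concave function that dominates `s` at `0, 1, …, n`. -/
def IsConcaveMajorant (n : ℕ) (s : ℕ → ℝ) (C : ℝ → ℝ) : Prop :=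
  (ConcaveOn ℝ (Set.Icc 0 (n : ℝ)) C ∧ ∀ j : ℕ, j ≤ n → s j ≤ C j) ∧
  ∀ D : ℝ → ℝ, ConcaveOn ℝ (Set.Icc 0 (n : ℝ)) D → (∀ j : ℕ, j ≤ n → s j ≤ D j) →
    ∀ t ∈ Set.Icc 0 (n : ℝ), C t ≤ D t

/-- The joint law of the increments is invariant under permutations. -/
def Exchangeable {Ω : Type*} [MeasurableSpace Ω] (μ : Measure Ω) {n : ℕ}
    (X : Ω → Fin n → ℝ) : Prop :=
  ∀ π : Equiv.Perm (Fin n), IdentDistrib (fun ω => X ω ∘ π) X μ μ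

/-- `L` is distributed like the partition of `n` by the cycle lengths (fixed points included) of a
uniform random permutation of `n` objects. -/
def HasCycleLengthLaw {Ω : Type*} [MeasurableSpace Ω] (μ : Measure Ω) {n : ℕ}
    (L : Ω → Nat.Partition n) : Prop :=
  ∀ p : Nat.Partition n, μ.real {ω | L ω = p} =
    (Finset.card {π : Equiv.Perm (Fin n) | π.partition.parts = p.parts} : ℝ) / n.factorial

open Classical in
/-- Conditionally given `(X, L)`, the permutation `ρ` is uniform on the set of admissible
rearrangements. -/
def IsUniformAdmissible {Ω : Type*} [MeasurableSpace Ω] (μ : Measure Ω) {n : ℕ}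
    (X : Ω → Fin n → ℝ) (L : Ω → Nat.Partition n) (ρ : Ω → Equiv.Perm (Fin n)) : Prop :=
  ∀ σ : Equiv.Perm (Fin n),
    μ⟦{ω | ρ ω = σ} | MeasurableSpace.comap (fun ω => (X ω, L ω)) inferInstance⟧ =ᵐ[μ]
      fun ω => if σ ∈ admissible (L ω) (X ω)
        then 1 / ((admissible (L ω) (X ω)).card : ℝ) else 0

end CyclicRearrangement

end

open CyclicRearrangement

/-! The equality in law reduces to a deterministic identity. Condition on `ρ = σ` and `L = p`.
Independence pulls out the probability of `p`, and exchangeability replaces `X ∘ σ` by `X`, so that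
the increments fed to the admissibility condition become `X ∘ σ⁻¹`. It remains to show that for
every fixed `y` the weights "probability of `p`, times the uniform probability of `σ` in the
admissible set for `y ∘ σ⁻¹`" sum to one over `p` and `σ` (`sum_cycleProb_mul_sum_admissible`).

For fixed `p`, each arrangement is `arrange p τ r` for exactly one order `τ` and one family of
shifts `r`. It is admissible for `y ∘ σ⁻¹` exactly when the blocks in the order `τ` run along the
concave majorant of the walk of `y`, whatever `r` is. The admissible set then has size (product of
factorials of multiplicities of slopes) × (product over blocks of the number of times the walk
touches the chord), again independent of `r` (`card_admissible_comp_symm`). Summing over `r` gives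
the product of the block lengths. Cauchy's formula cancels this product and leaves the factor that
turns a sum over orders into a sum over compositions of `n`.

What remains is `sum_pathWeight`: the weights of the compositions that follow the concave majorant
sum to one. On a face with `a` touching points, the cuts into `k` blocks have total weight `[X^a]
F^k / k!` with `F = -log (1 - X)`, since each block contributes one over its number of touches.
Summing over `k` gives the coefficient of `exp F = 1 / (1 - X)`, which is 1. The formal proof peels
off the first block and inducts on the length of the path.

For the concave majorant, the infimum of the lines through the block chords is concave, agrees with
each chord over its own block, and is minimal because any dominating concave function lies above
these chords. -/

namespace CyclicRearrangement

/-! ### The power series of `-log (1 - X)` -/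

/-- The power series `∑ X ^ j / j` of `-log (1 - X)`. -/
noncomputable def negLogSeries : PowerSeries ℝ := PowerSeries.mk fun j => (j : ℝ)⁻¹

open PowerSeries in
theorem derivative_negLogSeries :
    PowerSeries.derivative ℝ negLogSeries = PowerSeries.mk 1 := by
  ext j
  rw [PowerSeries.coeff_derivative]
  simp only [negLogSeries, PowerSeries.coeff_mk, Pi.one_apply]
  push_cast
  have : (j : ℝ) + 1 ≠ 0 := by positivity
  field_simp

theorem coeff_negLogSeries_pow_zero (a : ℕ) :
    PowerSeries.coeff a (negLogSeries ^ 0) = if a = 0 then 1 else 0 := by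
  rw [pow_zero, PowerSeries.coeff_one]

theorem coeff_negLogSeries_pow_succ (k a : ℕ) :
    PowerSeries.coeff a (negLogSeries ^ (k + 1)) =
      ∑ i ∈ Finset.Icc 1 a, (i : ℝ)⁻¹ * PowerSeries.coeff (a - i) (negLogSeries ^ k) := by
  rw [pow_succ', PowerSeries.coeff_mul, Finset.Nat.sum_antidiagonal_eq_sum_range_succ_mk,
    Finset.sum_range_succ', ← Finset.Ico_add_one_right_eq_Icc, Finset.sum_Ico_eq_sum_range]
  simp [negLogSeries, add_comm]

theorem coeff_negLogSeries_pow_of_lt {k a : ℕ} (h : a < k) :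
    PowerSeries.coeff a (negLogSeries ^ k) = 0 := by
  have h1 : PowerSeries.X ∣ negLogSeries := by
    rw [PowerSeries.X_dvd_iff, ← PowerSeries.coeff_zero_eq_constantCoeff_apply]
    -- The constant coefficient is `(0 : ℝ)⁻¹`, which is zero by convention, as the logarithm
    -- requires.
    simp [negLogSeries]
  exact PowerSeries.X_pow_dvd_iff.1 (pow_dvd_pow_of_dvd h1 k) a h

/-- This is `(F ^ (k + 1))' = (k + 1) F ^ k / (1 - X)` read off coefficientwise; multiplication by
`1 / (1 - X)` produces the partial sums. -/
theorem mul_coeff_negLogSeries_pow_succ (k a : ℕ) :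
    ((a : ℝ) + 1) * PowerSeries.coeff (a + 1) (negLogSeries ^ (k + 1)) =
      (k + 1) * ∑ j ∈ Finset.range (a + 1), PowerSeries.coeff j (negLogSeries ^ k) := by
  have h := PowerSeries.coeff_derivative (negLogSeries ^ (k + 1)) a
  rw [Derivation.leibniz_pow, derivative_negLogSeries] at h
  rw [mul_comm, ← h, add_tsub_cancel_right, smul_eq_mul, map_nsmul, PowerSeries.coeff_mul,
    Finset.Nat.sum_antidiagonal_eq_sum_range_succ_mk]
  simp

/-- The identity `exp (-log (1 - X)) = 1 / (1 - X)`, truncated harmlessly because `F ^ k` has order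
at least `k`. The derivative recurrence expresses `a + 1` times the sum at `a + 1` through the sums
at `0, …, a`, each equal to 1. -/
theorem sum_coeff_negLogSeries_pow_div_factorial (a N : ℕ) (h : a < N) :
    ∑ k ∈ Finset.range N, PowerSeries.coeff a (negLogSeries ^ k) / (k.factorial : ℝ) = 1 := by
  induction a using Nat.strong_induction_on generalizing N with
  | _ a ih =>
  obtain ⟨N, rfl⟩ : ∃ M, N = M + 1 := ⟨N - 1, by omega⟩
  rcases a with _ | a
  · rw [Finset.sum_range_succ', Finset.sum_eq_zero]
    · simp
    · intro k _
      rw [coeff_negLogSeries_pow_of_lt (by omega), zero_div]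
  · have ha : (a : ℝ) + 1 ≠ 0 := by positivity
    apply mul_left_cancel₀ ha
    rw [Finset.sum_range_succ', coeff_negLogSeries_pow_zero, if_neg (by omega), zero_div, add_zero,
      Finset.mul_sum]
    have : ∀ k ∈ Finset.range N, ((a : ℝ) + 1) *
        (PowerSeries.coeff (a + 1) (negLogSeries ^ (k + 1)) / ((k + 1).factorial : ℝ)) =
        ∑ j ∈ Finset.range (a + 1), PowerSeries.coeff j (negLogSeries ^ k) / (k.factorial : ℝ) := by
      intro k _
      rw [← mul_div_assoc, mul_coeff_negLogSeries_pow_succ, Nat.factorial_succ, ← Finset.sum_div]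
      push_cast
      have : (k : ℝ) + 1 ≠ 0 := by positivity
      rw [mul_div_mul_left _ _ this]
    rw [Finset.sum_congr rfl this, Finset.sum_comm, Finset.sum_congr rfl
      (fun j hj => ih j (by simp at hj; omega) N (by simp at hj; omega))]
    simp

/-! ### Finite sums -/

/-- The rank of `j` in `S` takes each value `1, …, |S|` once. This converts a sum over touching
points into a sum over their ranks. -/
theorem sum_card_filter_le {α M : Type*} [LinearOrder α] [AddCommMonoid M] (S : Finset α)
    (h : ℕ → M) :
    ∑ j ∈ S, h (S.filter (· ≤ j)).card = ∑ i ∈ Finset.Icc 1 S.card, h i := by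
  induction S using Finset.induction_on_max with
  | empty => simp
  | insert a s ha ih =>
    have hna : a ∉ s := fun h => lt_irrefl _ (ha a h)
    rw [Finset.sum_insert hna, Finset.card_insert_of_notMem hna,
      Finset.sum_Icc_succ_top (by omega), ← ih, add_comm]
    congr 1
    · refine Finset.sum_congr rfl fun j hj => ?_
      rw [Finset.filter_insert, if_neg (not_le.2 (ha j hj))]
    · rw [Finset.filter_true_of_mem, Finset.card_insert_of_notMem hna]
      intro x hx
      rcases Finset.mem_insert.1 hx with rfl | hx
      · exact le_rfl
      · exact (ha x hx).le

/-- The lists of positive integers with sum `d`. -/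
noncomputable def comps (d : ℕ) : Finset (List ℕ) :=
  Finset.univ.image fun c : Composition d => c.blocks

theorem mem_comps {d : ℕ} {l : List ℕ} : l ∈ comps d ↔ (∀ i ∈ l, 0 < i) ∧ l.sum = d := by
  simp only [comps, Finset.mem_image, Finset.mem_univ, true_and]
  constructor
  · rintro ⟨c, rfl⟩
    exact ⟨fun i hi => c.blocks_pos hi, c.blocks_sum⟩
  · rintro ⟨h1, h2⟩
    exact ⟨⟨l, fun {i} hi => h1 i hi, h2⟩, rfl⟩

theorem comps_zero : comps 0 = {[]} := by
  ext l
  rw [mem_comps, Finset.mem_singleton]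
  constructor
  · rintro ⟨h1, h2⟩
    rw [List.sum_eq_zero_iff] at h2
    exact List.eq_nil_iff_forall_not_mem.2 fun i hi => (h1 i hi).ne' (h2 i hi)
  · rintro rfl; simp

theorem cons_mem_comps {d j : ℕ} {l : List ℕ} :
    j :: l ∈ comps d ↔ j ∈ Finset.Icc 1 d ∧ l ∈ comps (d - j) := by
  simp only [mem_comps, List.mem_cons, forall_eq_or_imp, List.sum_cons, Finset.mem_Icc]
  constructor
  · rintro ⟨⟨h1, h2⟩, h3⟩
    exact ⟨⟨h1, by omega⟩, h2, by omega⟩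
  · rintro ⟨⟨h1, h2⟩, h3, h4⟩
    exact ⟨⟨h1, h3⟩, by omega⟩

theorem sum_comps {M : Type*} [AddCommMonoid M] {d : ℕ} (hd : 0 < d) (g : List ℕ → M) :
    ∑ l ∈ comps d, g l = ∑ j ∈ Finset.Icc 1 d, ∑ l ∈ comps (d - j), g (j :: l) := by
  rw [Finset.sum_sigma']
  symm
  refine Finset.sum_bij (fun x _ => x.1 :: x.2) ?_ ?_ ?_ (fun _ _ => rfl)
  · rintro ⟨j, l⟩ h
    exact cons_mem_comps.2 (Finset.mem_sigma.1 h)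
  · rintro ⟨j, l⟩ _ ⟨j', l'⟩ _ h
    obtain ⟨rfl, rfl⟩ := List.cons.inj h
    rfl
  · rintro (_ | ⟨j, l⟩) h
    · exact absurd (mem_comps.1 h).2.symm (by simpa using hd.ne')
    · exact ⟨⟨j, l⟩, Finset.mem_sigma.2 (cons_mem_comps.1 h), rfl⟩

/-- The product of the factorials of the multiplicities of the entries of a list. -/
def multFactorial {α : Type*} [DecidableEq α] (l : List α) : ℕ :=
  ∏ v ∈ l.toFinset, (l.count v).factorial

theorem multFactorial_pos {α : Type*} [DecidableEq α] (l : List α) : 0 < multFactorial l :=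
  Finset.prod_pos fun _ _ => Nat.factorial_pos _

theorem multFactorial_eq_prod_of_subset {α : Type*} [DecidableEq α] (l : List α) {s : Finset α}
    (h : l.toFinset ⊆ s) : multFactorial l = ∏ v ∈ s, (l.count v).factorial := by
  refine Finset.prod_subset h fun v _ hv => ?_
  rw [List.count_eq_zero_of_not_mem (fun hh => hv (List.mem_toFinset.2 hh)), Nat.factorial_zero]

theorem multFactorial_cons {α : Type*} [DecidableEq α] (v : α) (l : List α) :
    multFactorial (v :: l) = (l.count v + 1) * multFactorial l := by
  rw [multFactorial_eq_prod_of_subset l (s := (v :: l).toFinset)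
    (fun w hw => by simp only [List.mem_toFinset, List.mem_cons] at hw ⊢; exact Or.inr hw),
    multFactorial,
    ← Finset.mul_prod_erase (a := v) _ (fun w => ((v :: l).count w).factorial) (by simp),
    ← Finset.mul_prod_erase (a := v) _ (fun w => (l.count w).factorial) (by simp),
    List.count_cons_self, Nat.factorial_succ, mul_assoc]
  congr 2
  refine Finset.prod_congr rfl fun w hw => ?_
  rw [List.count_cons_of_ne (Finset.ne_of_mem_erase hw).symm]

/-! ### Slopes of walks -/

theorem walk_add {n : ℕ} (y : Fin n → ℝ) (s m : ℕ) :
    walk y (s + m) = walk y s + m * segMean y s m := by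
  have h : walk y (s + m) = walk y s + ∑ a : Fin n with s ≤ a.val ∧ a.val < s + m, y a := by
    rw [walk, walk, ← Finset.sum_union]
    · congr 1
      ext a
      simp only [Finset.mem_filter, Finset.mem_univ, true_and, Finset.mem_union]
      omega
    · rw [Finset.disjoint_filter]
      intro a _ h1 h2
      omega
  rw [h, segMean]
  rcases m.eq_zero_or_pos with rfl | hm
  · rw [Finset.filter_false_of_mem (fun a _ => by omega)]
    simp
  · have : (m : ℝ) ≠ 0 := by positivity
    field_simp

theorem segMean_le_iff {n : ℕ} (y : Fin n → ℝ) (s : ℕ) {m : ℕ} (hm : 1 ≤ m) (v : ℝ) :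
    segMean y s m ≤ v ↔ walk y (s + m) ≤ walk y s + m * v := by
  have : (0 : ℝ) < m := by positivity
  rw [walk_add, add_le_add_iff_left, mul_le_mul_iff_right₀ this]

theorem segMean_eq_iff {n : ℕ} (y : Fin n → ℝ) (s : ℕ) {m : ℕ} (hm : 1 ≤ m) (v : ℝ) :
    segMean y s m = v ↔ walk y (s + m) = walk y s + m * v := by
  have : (m : ℝ) ≠ 0 := by positivity
  rw [walk_add, add_right_inj, mul_right_inj' this]

/-- The walk at `s + j` lies on the line of slope `v` through its value at `s`, so both comparisons
are with the same line. -/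
theorem segMean_add_le_iff {n : ℕ} {y : Fin n → ℝ} {s j m : ℕ} (hj : 1 ≤ j) (hm : 1 ≤ m) {v : ℝ}
    (h : segMean y s j = v) : segMean y (s + j) m ≤ v ↔ segMean y s (j + m) ≤ v := by
  rw [segMean_le_iff _ _ hm, segMean_le_iff _ _ (by omega), (segMean_eq_iff _ _ hj _).1 h,
    add_assoc s j m]
  push_cast
  rw [show walk y s + j * v + m * v = walk y s + (j + m) * v by ring]

theorem segMean_add_eq_iff {n : ℕ} {y : Fin n → ℝ} {s j m : ℕ} (hj : 1 ≤ j) (hm : 1 ≤ m) {v : ℝ}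
    (h : segMean y s j = v) : segMean y (s + j) m = v ↔ segMean y s (j + m) = v := by
  rw [segMean_eq_iff _ _ hm, segMean_eq_iff _ _ (by omega), (segMean_eq_iff _ _ hj _).1 h,
    add_assoc s j m]
  push_cast
  rw [show walk y s + j * v + m * v = walk y s + (j + m) * v by ring]

/-! ### Paths of blocks along the concave majorant -/

/-- The pairs (starting point, length) of consecutive blocks, the first of which starts at `u`. -/
def blocksFrom : ℕ → List ℕ → List (ℕ × ℕ)
  | _, [] => []
  | u, j :: c => (u, j) :: blocksFrom (u + j) c

/-- The slopes of a walk over consecutive blocks. -/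
noncomputable def slopes {n : ℕ} (y : Fin n → ℝ) (u : ℕ) (c : List ℕ) : List ℝ :=
  (blocksFrom u c).map fun b => segMean y b.1 b.2

/-- Within the block of length `j` starting at `u`, the walk stays below the chord. -/
def UnderChord {n : ℕ} (y : Fin n → ℝ) (u j : ℕ) : Prop :=
  ∀ m : ℕ, 1 ≤ m → m ≤ j → segMean y u m ≤ segMean y u j

/-- The walk stays below the chords of the blocks, and their slopes are non-increasing. -/
def MajorantPath {n : ℕ} (y : Fin n → ℝ) (u : ℕ) (c : List ℕ) : Prop :=
  (slopes y u c).Pairwise (fun s t => t ≤ s) ∧ ∀ b ∈ blocksFrom u c, UnderChord y b.1 b.2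

/-- The number of times the walk touches the chord of a block, apart from its left end. -/
noncomputable def touchCount {n : ℕ} (y : Fin n → ℝ) (u j : ℕ) : ℕ :=
  Finset.card {m ∈ Finset.Icc 1 j | segMean y u m = segMean y u j}

/-- One over the number of ways to permute blocks of equal slope and to rotate each block with the
walk remaining below the chords. -/
noncomputable def pathWeight {n : ℕ} (y : Fin n → ℝ) (u : ℕ) (c : List ℕ) : ℝ :=
  ((multFactorial (slopes y u c) : ℝ) *
    ((blocksFrom u c).map fun b => (touchCount y b.1 b.2 : ℝ)).prod)⁻¹

variable {n : ℕ} {y : Fin n → ℝ}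

theorem slopes_cons (u j : ℕ) (c : List ℕ) :
    slopes y u (j :: c) = segMean y u j :: slopes y (u + j) c := rfl

theorem majorantPath_nil (u : ℕ) : MajorantPath y u [] := by
  simp [MajorantPath, slopes, blocksFrom]

theorem majorantPath_cons {u j : ℕ} {c : List ℕ} :
    MajorantPath y u (j :: c) ↔ (∀ s ∈ slopes y (u + j) c, s ≤ segMean y u j) ∧
      UnderChord y u j ∧ MajorantPath y (u + j) c := by
  simp only [MajorantPath, slopes_cons, blocksFrom, List.pairwise_cons, List.mem_cons,
    forall_eq_or_imp]
  tauto

theorem pathWeight_cons (u j : ℕ) (c : List ℕ) :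
    pathWeight y u (j :: c) = (touchCount y u j : ℝ)⁻¹ *
      (((slopes y (u + j) c).count (segMean y u j) : ℝ) + 1)⁻¹ * pathWeight y (u + j) c := by
  simp only [pathWeight, slopes_cons, multFactorial_cons, blocksFrom, List.map_cons,
    List.prod_cons, mul_inv]
  push_cast
  rw [mul_inv]
  ring

theorem MajorantPath.walk_le {u : ℕ} {c : List ℕ} (h : MajorantPath y u c) {v : ℝ}
    (hv : ∀ s ∈ slopes y u c, s ≤ v) {m : ℕ} (hm : m ≤ c.sum) :
    walk y (u + m) ≤ walk y u + m * v := by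
  induction c generalizing u m with
  | nil =>
    obtain rfl : m = 0 := by simpa using hm
    simp
  | cons j c ih =>
    obtain ⟨h1, h2, h3⟩ := majorantPath_cons.1 h
    simp only [slopes_cons, List.mem_cons, forall_eq_or_imp] at hv
    rcases Nat.eq_zero_or_pos m with rfl | hm0
    · simp
    rcases le_total m j with hmj | hmj
    · exact (segMean_le_iff _ _ hm0 _).1 ((h2 m hm0 hmj).trans hv.1)
    · obtain ⟨m, rfl⟩ := Nat.exists_eq_add_of_le hmj
      have h4 := ih h3 hv.2 (m := m) (by simpa using hm)
      have h5 : walk y (u + j) ≤ walk y u + j * v := by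
        rw [walk_add]
        gcongr
        exact hv.1
      rw [← add_assoc]
      push_cast
      linarith

theorem MajorantPath.slopes_le {u d : ℕ} {c : List ℕ} (h : MajorantPath y u c) (hc : c ∈ comps d)
    {v : ℝ} (hv : ∀ m, 1 ≤ m → m ≤ d → segMean y u m ≤ v) : ∀ s ∈ slopes y u c, s ≤ v := by
  rcases c with _ | ⟨j, c⟩
  · simp [slopes, blocksFrom]
  · obtain ⟨hj, -⟩ := cons_mem_comps.1 hc
    rw [Finset.mem_Icc] at hj
    have h0 := hv j hj.1 hj.2
    simp only [slopes_cons, List.mem_cons, forall_eq_or_imp]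
    exact ⟨h0, fun s hs => ((majorantPath_cons.1 h).1 s hs).trans h0⟩

/-- The first slope of a path along the concave majorant is the largest slope. -/
theorem MajorantPath.segMean_le {u j d : ℕ} {c : List ℕ} (h : MajorantPath y u (j :: c))
    (hc : j :: c ∈ comps d) {m : ℕ} (hm : 1 ≤ m) (hmd : m ≤ d) :
    segMean y u m ≤ segMean y u j := by
  rw [segMean_le_iff _ _ hm]
  refine h.walk_le ?_ (by rw [(mem_comps.1 hc).2]; exact hmd)
  simp only [slopes_cons, List.mem_cons, forall_eq_or_imp]
  exact ⟨le_rfl, (majorantPath_cons.1 h).1⟩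

open Classical in
-- Since `v` is the largest slope and is attained, the first block must end at a touching point of
-- the line of slope `v`. If that is the `i`-th of `a` such points, the block touches its chord `i`
-- times and `a - i` touching points remain. So the weight gains the factor `1 / (i (k + 1))`, and
-- the sum over `i` is the convolution defining the coefficient of `F ^ (k + 1)`.
theorem sum_pathWeight_count_eq_of_touch {d u k : ℕ} {v : ℝ}
    (ih : ∀ d' < d, ∀ (u k : ℕ) (v : ℝ), (∀ m, 1 ≤ m → m ≤ d' → segMean y u m ≤ v) →
      ∑ c ∈ comps d' with MajorantPath y u c ∧ (slopes y u c).count v = k, pathWeight y u c =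
        PowerSeries.coeff (Finset.card {m ∈ Finset.Icc 1 d' | segMean y u m = v})
          (negLogSeries ^ k) / (k.factorial : ℝ))
    (hv : ∀ m, 1 ≤ m → m ≤ d → segMean y u m ≤ v) (hd : 0 < d)
    (hm : ∃ m, 1 ≤ m ∧ m ≤ d ∧ segMean y u m = v) :
    ∑ c ∈ comps d with MajorantPath y u c ∧ (slopes y u c).count v = k, pathWeight y u c =
      PowerSeries.coeff (Finset.card {m ∈ Finset.Icc 1 d | segMean y u m = v})
        (negLogSeries ^ k) / (k.factorial : ℝ) := by
  obtain ⟨m₀, hm₀, hm₀d, hm₀v⟩ := hm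
  have hfirst : ∀ j c, j :: c ∈ comps d → MajorantPath y u (j :: c) → segMean y u j = v := by
    intro j c hc h
    have hj := Finset.mem_Icc.1 (cons_mem_comps.1 hc).1
    exact le_antisymm (hv j hj.1 hj.2) (hm₀v ▸ h.segMean_le hc hm₀ hm₀d)
  rcases k with _ | k
  · rw [coeff_negLogSeries_pow_zero, if_neg, zero_div, Finset.sum_eq_zero]
    · intro c hc
      rw [Finset.mem_filter] at hc
      obtain ⟨hc, h1, h2⟩ := hc
      rcases c with _ | ⟨j, c⟩
      · exact absurd (mem_comps.1 hc).2.symm (by simpa using hd.ne')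
      · rw [slopes_cons, hfirst j c hc h1, List.count_cons_self] at h2
        omega
    · exact (Finset.card_pos.2 ⟨m₀, by simp [hm₀, hm₀d, hm₀v]⟩).ne'
  set S := {m ∈ Finset.Icc 1 d | segMean y u m = v} with hS
  have hinner : ∀ j ∈ Finset.Icc 1 d, (∑ c ∈ comps (d - j),
      if MajorantPath y u (j :: c) ∧ (slopes y u (j :: c)).count v = k + 1
        then pathWeight y u (j :: c) else 0) =
      if segMean y u j = v then
        (fun i : ℕ => (i : ℝ)⁻¹ * PowerSeries.coeff (S.card - i) (negLogSeries ^ k) /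
          ((k + 1).factorial : ℝ)) (S.filter (· ≤ j)).card else 0 := by
    intro j hj
    have hj' := Finset.mem_Icc.1 hj
    split_ifs with hjv
    swap
    · refine Finset.sum_eq_zero fun c hc => if_neg fun h => hjv ?_
      exact hfirst j c (cons_mem_comps.2 ⟨hj, hc⟩) h.1
    have hv' : ∀ m, 1 ≤ m → m ≤ d - j → segMean y (u + j) m ≤ v := fun m h1 h2 =>
      (segMean_add_le_iff hj'.1 h1 hjv).2 (hv _ (by omega) (by omega))
    have hchord : UnderChord y u j := fun m h1 h2 => hjv ▸ hv m h1 (by omega)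
    -- Translation by `j` identifies the touching points of the remaining path with those of the
    -- whole path beyond `j`.
    have hcard : Finset.card {m ∈ Finset.Icc 1 (d - j) | segMean y (u + j) m = v} =
        S.card - (S.filter (· ≤ j)).card := by
      have h1 := Finset.card_filter_add_card_filter_not (s := S) (fun m => m ≤ j)
      rw [← h1, Nat.add_sub_cancel_left]
      refine Finset.card_bij (fun m _ => j + m) ?_ (by simp) ?_
      · intro m hm
        simp only [hS, Finset.mem_filter, Finset.mem_Icc] at hm ⊢
        exact ⟨⟨by omega, (segMean_add_eq_iff hj'.1 hm.1.1 hjv).1 hm.2⟩, by omega⟩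
      · intro m hm
        simp only [hS, Finset.mem_filter, Finset.mem_Icc] at hm
        obtain ⟨m, rfl⟩ := Nat.exists_eq_add_of_le (show j ≤ m by omega)
        refine ⟨m, ?_, rfl⟩
        simp only [Finset.mem_filter, Finset.mem_Icc]
        exact ⟨by omega, (segMean_add_eq_iff hj'.1 (by omega) hjv).2 hm.1.2⟩
    have htouch : touchCount y u j = (S.filter (· ≤ j)).card := by
      rw [touchCount]
      congr 1
      ext m
      simp only [hS, hjv, Finset.mem_filter, Finset.mem_Icc]
      constructor
      · rintro ⟨h1, h2⟩; exact ⟨⟨by omega, h2⟩, h1.2⟩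
      · rintro ⟨h1, h2⟩; exact ⟨⟨h1.1.1, h2⟩, h1.2⟩
    have hstep : ∀ c ∈ comps (d - j),
        (if MajorantPath y u (j :: c) ∧ (slopes y u (j :: c)).count v = k + 1
          then pathWeight y u (j :: c) else 0) =
        ((S.filter (· ≤ j)).card : ℝ)⁻¹ * ((k : ℝ) + 1)⁻¹ *
          if MajorantPath y (u + j) c ∧ (slopes y (u + j) c).count v = k
            then pathWeight y (u + j) c else 0 := by
      intro c hc
      have hiff : MajorantPath y u (j :: c) ↔ MajorantPath y (u + j) c := by
        rw [majorantPath_cons, hjv]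
        exact ⟨fun h => h.2.2, fun h => ⟨h.slopes_le hc hv', hchord, h⟩⟩
      rw [mul_ite, mul_zero]
      refine if_ctx_congr ?_ (fun h => ?_) (fun _ => rfl)
      · rw [slopes_cons, hjv, List.count_cons_self, add_left_inj, hiff]
      · rw [pathWeight_cons, hjv, h.2, htouch]
    rw [Finset.sum_congr rfl hstep, ← Finset.mul_sum, ← Finset.sum_filter,
      ih (d - j) (by omega) (u + j) k v hv', hcard, Nat.factorial_succ]
    push_cast
    rw [div_eq_mul_inv, div_eq_mul_inv, mul_inv]
    ring
  rw [Finset.sum_filter, sum_comps hd, Finset.sum_congr rfl hinner, ← Finset.sum_filter,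
    sum_card_filter_le S (fun i : ℕ => (i : ℝ)⁻¹ * PowerSeries.coeff (S.card - i) (negLogSeries ^ k) /
          ((k + 1).factorial : ℝ)), coeff_negLogSeries_pow_succ, Finset.sum_div]

open Classical in
-- Split by the multiplicity of the slope `v`, which is at most `d` because blocks are nonempty, and
-- apply the exponential identity.
theorem sum_pathWeight_eq_one_of_count {d u : ℕ} {v : ℝ}
    (h : ∀ k, ∑ c ∈ comps d with MajorantPath y u c ∧ (slopes y u c).count v = k,
      pathWeight y u c = PowerSeries.coeff (Finset.card {m ∈ Finset.Icc 1 d | segMean y u m = v})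
        (negLogSeries ^ k) / (k.factorial : ℝ)) :
    ∑ c ∈ comps d with MajorantPath y u c, pathWeight y u c = 1 := by
  have hcount : ∀ c ∈ comps d, (slopes y u c).count v ≤ d := by
    intro c hc
    obtain ⟨h1, h2⟩ := mem_comps.1 hc
    have h3 : ∀ (c : List ℕ) (u : ℕ), (blocksFrom u c).length = c.length := by
      intro c
      induction c with
      | nil => intro u; rfl
      | cons j c ih => intro u; simp [blocksFrom, ih]
    calc (slopes y u c).count v ≤ (slopes y u c).length := List.count_le_length
      _ = c.length := by rw [slopes, List.length_map, h3]
      _ ≤ c.sum := List.length_le_sum_of_one_le c h1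
      _ = d := h2
  rw [← Finset.sum_fiberwise_of_maps_to (t := Finset.range (d + 1))
    (g := fun c => (slopes y u c).count v)
    (fun c hc => Finset.mem_range.2 (Nat.lt_succ_of_le (hcount c (Finset.mem_filter.1 hc).1)))]
  simp_rw [Finset.filter_filter, h]
  refine sum_coeff_negLogSeries_pow_div_factorial _ _ (Nat.lt_succ_of_le ?_)
  simpa using Finset.card_filter_le (Finset.Icc 1 d) (fun m => segMean y u m = v)

open Classical in
/-- The total weight of the paths along the concave majorant with a given number of blocks on a
face of slope `v`. -/
theorem sum_pathWeight_count_eq (d : ℕ) : ∀ (u k : ℕ) (v : ℝ),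
    (∀ m, 1 ≤ m → m ≤ d → segMean y u m ≤ v) →
    ∑ c ∈ comps d with MajorantPath y u c ∧ (slopes y u c).count v = k, pathWeight y u c =
      PowerSeries.coeff (Finset.card {m ∈ Finset.Icc 1 d | segMean y u m = v})
        (negLogSeries ^ k) / (k.factorial : ℝ) := by
  induction d using Nat.strong_induction_on with
  | _ d ih =>
  intro u k v hv
  rcases Nat.eq_zero_or_pos d with rfl | hd
  · rw [comps_zero, Finset.sum_filter, Finset.sum_singleton]
    rcases k with _ | k
    · rw [if_pos ⟨majorantPath_nil u, rfl⟩]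
      simp [pathWeight, slopes, blocksFrom, multFactorial]
    · rw [if_neg (by simp [slopes, blocksFrom]), coeff_negLogSeries_pow_of_lt (by simp), zero_div]
  by_cases hm : ∃ m, 1 ≤ m ∧ m ≤ d ∧ segMean y u m = v
  · exact sum_pathWeight_count_eq_of_touch ih hv hd hm
  -- Here `v` is never attained. The case already proved, at the true maximal slope, shows that all
  -- weights sum to 1; as no path has slope `v`, this total sits entirely at `k = 0`.
  obtain ⟨m₀, hm₀, hmax⟩ := Finset.exists_max_image (Finset.Icc 1 d) (segMean y u)
    ⟨1, Finset.mem_Icc.2 ⟨le_rfl, hd⟩⟩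
  rw [Finset.mem_Icc] at hm₀
  have hv₀ : ∀ m, 1 ≤ m → m ≤ d → segMean y u m ≤ segMean y u m₀ := fun m h1 h2 =>
    hmax m (Finset.mem_Icc.2 ⟨h1, h2⟩)
  have hlt : segMean y u m₀ < v :=
    lt_of_le_of_ne (hv _ hm₀.1 hm₀.2) fun h => hm ⟨m₀, hm₀.1, hm₀.2, h⟩
  have hzero : ∀ c ∈ comps d, MajorantPath y u c → (slopes y u c).count v = 0 := fun c hc h =>
    List.count_eq_zero_of_not_mem fun hmem => (h.slopes_le hc hv₀ v hmem).not_gt hlt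
  have htotal := sum_pathWeight_eq_one_of_count fun k =>
    sum_pathWeight_count_eq_of_touch (k := k) ih hv₀ hd ⟨m₀, hm₀.1, hm₀.2, rfl⟩
  have hcard : Finset.card {m ∈ Finset.Icc 1 d | segMean y u m = v} = 0 := by
    rw [Finset.card_eq_zero, Finset.filter_eq_empty_iff]
    intro m hmem h
    rw [Finset.mem_Icc] at hmem
    exact hm ⟨m, hmem.1, hmem.2, h⟩
  rw [hcard]
  rcases k with _ | k
  · rw [coeff_negLogSeries_pow_zero, if_pos rfl, Nat.factorial_zero, Nat.cast_one, div_one,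
      ← htotal]
    refine Finset.sum_congr (Finset.filter_congr fun c hc => ?_) fun _ _ => rfl
    exact ⟨fun h => h.1, fun h => ⟨h, hzero c hc h⟩⟩
  · rw [coeff_negLogSeries_pow_of_lt (by simp), zero_div, Finset.sum_eq_zero]
    intro c hc
    obtain ⟨h1, h2, h3⟩ := Finset.mem_filter.1 hc
    rw [hzero c h1 h2] at h3
    omega

open Classical in
theorem sum_pathWeight (y : Fin n → ℝ) (u d : ℕ) :
    ∑ c ∈ comps d with MajorantPath y u c, pathWeight y u c = 1 := by
  obtain ⟨v, hv⟩ := ((Finset.Icc 1 d).image (segMean y u)).bddAbove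
  exact sum_pathWeight_eq_one_of_count fun k => sum_pathWeight_count_eq d u k v fun m h1 h2 =>
    hv (Finset.mem_coe.2 (Finset.mem_image_of_mem _ (Finset.mem_Icc.2 ⟨h1, h2⟩)))

/-! ### Summing over partitions and orders of their parts -/

theorem coe_lengths {n : ℕ} (p : Nat.Partition n) : (lengths p : Multiset ℕ) = p.parts :=
  Multiset.sort_eq _ _

theorem ofFn_blockLen {n : ℕ} (p : Nat.Partition n) : List.ofFn (blockLen p) = lengths p :=
  List.ofFn_get _

/-- Both sequences have the same sorted form; compose one sorting permutation with the inverse of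
the other. -/
theorem exists_ofFn_comp_perm {k : ℕ} (f : Fin k → ℕ) (l : List ℕ)
    (h : l.Perm (List.ofFn f)) : ∃ τ : Equiv.Perm (Fin k), List.ofFn (f ∘ τ) = l := by
  have hlen : l.length = k := by simpa using h.length_eq
  subst hlen
  obtain ⟨g, rfl⟩ : ∃ g : Fin l.length → ℕ, g = l.get := ⟨_, rfl⟩
  have hsort : f ∘ Tuple.sort f = l.get ∘ Tuple.sort l.get := by
    apply List.ofFn_injective
    refine List.Perm.eq_of_sortedLE ?_ ?_ ?_
    · exact List.sortedLE_ofFn_iff.2 (Tuple.monotone_sort f)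
    · exact List.sortedLE_ofFn_iff.2 (Tuple.monotone_sort _)
    · refine (Equiv.Perm.ofFn_comp_perm _ _).trans (h.symm.trans ?_)
      refine List.Perm.trans ?_ (Equiv.Perm.ofFn_comp_perm _ _).symm
      rw [List.ofFn_get]
  refine ⟨Tuple.sort f * (Tuple.sort l.get)⁻¹, ?_⟩
  conv_rhs => rw [← List.ofFn_get l]
  congr 1
  rw [Equiv.Perm.coe_mul, ← Function.comp_assoc, hsort, Function.comp_assoc,
    ← Equiv.Perm.coe_mul, mul_inv_cancel, Equiv.Perm.coe_one, Function.comp_id]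

theorem card_stabilizer_eq_multFactorial {α : Type*} [DecidableEq α] {k : ℕ} (f : Fin k → α) :
    Finset.card {τ : Equiv.Perm (Fin k) | f ∘ τ = f} = multFactorial (List.ofFn f) := by
  rw [← Fintype.card_subtype, DomMulAct.stabilizer_card', multFactorial]
  refine Finset.prod_congr ?_ fun v _ => ?_
  · ext v; simp [List.mem_ofFn]
  · congr 1
    rw [Fintype.card_subtype, ← Multiset.coe_count, ← Fin.univ_val_map, Multiset.count_map]
    simp only [eq_comm]
    rfl

theorem card_comp_perm_eq {α : Type*} [DecidableEq α] {k : ℕ} (f : Fin k → α)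
    (τ₀ : Equiv.Perm (Fin k)) :
    Finset.card {τ : Equiv.Perm (Fin k) | f ∘ τ = f ∘ τ₀} =
      Finset.card {τ : Equiv.Perm (Fin k) | f ∘ τ = f} := by
  refine Finset.card_bij (fun τ _ => τ * τ₀⁻¹) ?_ ?_ ?_
  · intro τ hτ
    simp only [Finset.mem_filter, Finset.mem_univ, true_and] at hτ ⊢
    rw [Equiv.Perm.coe_mul, ← Function.comp_assoc, hτ, Function.comp_assoc, ← Equiv.Perm.coe_mul,
      mul_inv_cancel, Equiv.Perm.coe_one, Function.comp_id]
  · intro τ _ τ' _ h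
    exact mul_right_cancel h
  · intro τ hτ
    simp only [Finset.mem_filter, Finset.mem_univ, true_and] at hτ
    refine ⟨τ * τ₀, ?_, by simp⟩
    simp only [Finset.mem_filter, Finset.mem_univ, true_and]
    rw [Equiv.Perm.coe_mul, ← Function.comp_assoc, hτ]

theorem ofFn_comp_mem_comps {n : ℕ} (p : Nat.Partition n)
    (τ : Equiv.Perm (Fin (numBlocks p))) : List.ofFn (blockLen p ∘ τ) ∈ comps n ∧
      (List.ofFn (blockLen p ∘ τ) : Multiset ℕ) = p.parts := by
  have h : (List.ofFn (blockLen p ∘ τ) : Multiset ℕ) = p.parts := by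
    rw [← coe_lengths, ← ofFn_blockLen]
    exact Quot.sound (Equiv.Perm.ofFn_comp_perm _ _)
  refine ⟨mem_comps.2 ⟨fun i hi => p.parts_pos ?_, ?_⟩, h⟩
  · rw [← h]; exact hi
  · rw [← Multiset.sum_coe, h, p.parts_sum]

/-- The orders yielding a given composition form a coset of the stabilizer of the length function,
whose size is the product of factorials of multiplicities. -/
theorem sum_perm_ofFn {n : ℕ} (p : Nat.Partition n) (g : List ℕ → ℝ) :
    ∑ τ : Equiv.Perm (Fin (numBlocks p)), g (List.ofFn (blockLen p ∘ τ)) =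
      multFactorial (lengths p) * ∑ c ∈ comps n with Multiset.ofList c = p.parts, g c := by
  rw [← Finset.sum_fiberwise_of_maps_to (s := Finset.univ)
    (t := (comps n).filter fun c : List ℕ => (c : Multiset ℕ) = p.parts)
    (g := fun τ : Equiv.Perm (Fin (numBlocks p)) => List.ofFn (blockLen p ∘ τ))
    (fun τ _ => Finset.mem_filter.2 (ofFn_comp_mem_comps p τ)), Finset.mul_sum]
  refine Finset.sum_congr rfl fun c hc => ?_
  obtain ⟨τ₀, rfl⟩ := exists_ofFn_comp_perm (blockLen p) c (by
    rw [ofFn_blockLen, ← Multiset.coe_eq_coe, coe_lengths, (Finset.mem_filter.1 hc).2])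
  rw [Finset.sum_congr rfl (g := fun _ => g (List.ofFn (blockLen p ∘ τ₀)))
    (fun τ hτ => by rw [(Finset.mem_filter.1 hτ).2]), Finset.sum_const, nsmul_eq_mul,
    ← ofFn_blockLen, ← card_stabilizer_eq_multFactorial, ← card_comp_perm_eq _ τ₀]
  simp only [List.ofFn_inj]

theorem sum_partition_sum_perm {n : ℕ} (g : List ℕ → ℝ) :
    ∑ p : Nat.Partition n, (multFactorial (lengths p) : ℝ)⁻¹ *
      ∑ τ : Equiv.Perm (Fin (numBlocks p)), g (List.ofFn (blockLen p ∘ τ)) =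
      ∑ c ∈ comps n, g c := by
  classical
  have h1 : ∀ p : Nat.Partition n, (multFactorial (lengths p) : ℝ)⁻¹ *
      ∑ τ : Equiv.Perm (Fin (numBlocks p)), g (List.ofFn (blockLen p ∘ τ)) =
      ∑ c ∈ comps n with Multiset.ofList c = p.parts, g c := by
    intro p
    have := multFactorial_pos (lengths p)
    rw [sum_perm_ofFn, inv_mul_cancel_left₀ (by positivity)]
  simp_rw [h1, Finset.sum_filter]
  rw [Finset.sum_comm]
  refine Finset.sum_congr rfl fun c hc => ?_
  obtain ⟨h2, h3⟩ := mem_comps.1 hc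
  rw [Finset.sum_eq_single (⟨(c : Multiset ℕ), fun {i} hi => h2 i hi, h3⟩ : Nat.Partition n)]
  · rw [if_pos rfl]
  · intro p _ hp
    rw [if_neg]
    exact fun h => hp (Nat.Partition.ext h.symm)
  · simp

/-! ### Cauchy's formula -/

theorem filter_two_le_add_replicate {s : Multiset ℕ} (hs : ∀ i ∈ s, 0 < i) :
    s.filter (2 ≤ ·) + Multiset.replicate (s.count 1) 1 = s := by
  conv_rhs => rw [← Multiset.filter_add_not (2 ≤ ·) s]
  rw [← Multiset.filter_eq']
  congr 1
  refine Multiset.filter_congr fun i hi => ?_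
  have := hs i hi
  omega

/-- The cycle type omits fixed points, but their number is forced by the total `n`. -/
theorem partition_parts_eq_iff {n : ℕ} (p : Nat.Partition n) (π : Equiv.Perm (Fin n)) :
    π.partition.parts = p.parts ↔ π.cycleType = p.parts.filter (2 ≤ ·) := by
  constructor
  · rintro h
    rw [← h, Equiv.Perm.filter_parts_partition_eq_cycleType]
  · intro h
    have h1 := filter_two_le_add_replicate (fun i hi => p.parts_pos (i := i) hi)
    have h2 := congrArg Multiset.sum h1
    rw [p.parts_sum, Multiset.sum_add, Multiset.sum_replicate] at h2
    rw [Equiv.Perm.parts_partition, ← Equiv.Perm.sum_cycleType, h, Fintype.card_fin]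
    conv_rhs => rw [← h1]
    congr 2
    simp at h2
    omega

theorem card_partition_mul_eq_factorial {n : ℕ} (p : Nat.Partition n) :
    Finset.card {π : Equiv.Perm (Fin n) | π.partition.parts = p.parts} *
      ((lengths p).prod * multFactorial (lengths p)) = n.factorial := by
  simp only [partition_parts_eq_iff]
  have h1 := filter_two_le_add_replicate (fun i hi => p.parts_pos (i := i) hi)
  have h2 := congrArg Multiset.sum h1
  have h3 := congrArg Multiset.prod h1
  rw [p.parts_sum, Multiset.sum_add, Multiset.sum_replicate, smul_eq_mul, mul_one] at h2
  rw [Multiset.prod_add, Multiset.prod_replicate, one_pow, mul_one] at h3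
  have h := Equiv.Perm.card_of_cycleType_mul_eq (Fin n) (p.parts.filter (2 ≤ ·))
  rw [if_pos ⟨by rw [Fintype.card_fin]; omega, fun a ha => (Multiset.mem_filter.1 ha).2⟩,
    Fintype.card_fin, show n - (p.parts.filter (2 ≤ ·)).sum = p.parts.count 1 by omega] at h
  rw [← h, ← Multiset.prod_coe, coe_lengths, h3]
  congr 1
  rw [mul_comm (Nat.factorial _), mul_assoc]
  congr 1
  -- The part 1 is singled out because the count by cycle type carries a separate factorial for the
  -- fixed points.
  rw [multFactorial_eq_prod_of_subset (s := insert 1 (p.parts.filter (2 ≤ ·)).toFinset),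
    Finset.prod_insert]
  · simp only [← Multiset.coe_count, coe_lengths]
    congr 1
    refine Finset.prod_congr rfl fun i hi => ?_
    rw [Multiset.count_filter_of_pos]
    exact (Multiset.mem_filter.1 (Multiset.mem_toFinset.1 hi)).2
  · simp
  · intro i hi
    rw [List.mem_toFinset, ← Multiset.mem_coe, coe_lengths] at hi
    have := p.parts_pos hi
    simp only [Finset.mem_insert, Multiset.mem_toFinset, Multiset.mem_filter]
    by_cases h : i = 1
    · exact Or.inl h
    · exact Or.inr ⟨hi, by omega⟩

/-! ### Good rotations of a finite sequence -/

section Rotation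

variable {L : ℕ} [NeZero L] (g : Fin L → ℝ)

/-- The mean of the first `m` entries. -/
noncomputable def prefixMean {L : ℕ} (g : Fin L → ℝ) (m : ℕ) : ℝ :=
  (∑ j : Fin L with j.val < m, g j) / m

/-- The mean of all entries. -/
noncomputable def mean {L : ℕ} (g : Fin L → ℝ) : ℝ := (∑ j, g j) / L

open Classical in
/-- The rotations of a sequence for which all prefix means are at most the total mean. -/
noncomputable def goodRotations : Finset (Fin L) :=
  {r | ∀ m, 1 ≤ m → m ≤ L → prefixMean (fun j => g (j + r)) m ≤ mean g}

/-- The partial sums of the centred periodic extension of a sequence. -/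
noncomputable def centredSum (s : ℕ) : ℝ :=
  ∑ j ∈ Finset.range s, (g (Fin.ofNat L j) - mean g)

theorem prefixMean_length {L : ℕ} (g : Fin L → ℝ) : prefixMean g L = mean g := by
  simp [prefixMean, mean]

theorem mean_rotate (r : Fin L) : mean (fun j => g (j + r)) = mean g := by
  rw [mean, mean, ← Equiv.sum_comp (Equiv.addRight r) g]
  rfl

theorem sum_filter_lt_rotate (r : Fin L) {m : ℕ} (hm : m ≤ L) :
    ∑ j : Fin L with j.val < m, g (j + r) = ∑ j ∈ Finset.range m, g (Fin.ofNat L (r + j)) := by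
  refine Finset.sum_bij (fun j _ => j.val) ?_ ?_ ?_ ?_
  · intro j hj; simpa using hj
  · intro j _ j' _ h; exact Fin.ext h
  · intro j hj
    rw [Finset.mem_range] at hj
    exact ⟨⟨j, by omega⟩, by simpa using hj, rfl⟩
  · intro j _
    congr 1
    ext
    simp [Fin.val_add, Fin.ofNat, add_comm]

theorem prefixMean_rotate_le_iff (r : Fin L) {m : ℕ} (hm0 : 1 ≤ m) (hm : m ≤ L) :
    prefixMean (fun j => g (j + r)) m ≤ mean g ↔
      centredSum g (r + m) ≤ centredSum g r := by
  have hm' : (0 : ℝ) < m := by positivity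
  rw [prefixMean, sum_filter_lt_rotate g r hm, div_le_iff₀ hm', centredSum, centredSum,
    Finset.sum_range_add, add_le_iff_nonpos_right, Finset.sum_sub_distrib, Finset.sum_const,
    Finset.card_range, nsmul_eq_mul, sub_nonpos, mul_comm]

theorem prefixMean_le_iff {m : ℕ} (hm0 : 1 ≤ m) (hm : m ≤ L) :
    prefixMean g m ≤ mean g ↔ centredSum g m ≤ 0 := by
  simpa [centredSum] using prefixMean_rotate_le_iff g 0 hm0 hm

theorem prefixMean_eq_iff {m : ℕ} (hm0 : 1 ≤ m) (hm : m ≤ L) :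
    prefixMean g m = mean g ↔ centredSum g m = 0 := by
  have hm' : (m : ℝ) ≠ 0 := by positivity
  have := sum_filter_lt_rotate g 0 hm
  simp only [add_zero, Fin.val_zero, zero_add] at this
  rw [prefixMean, this, div_eq_iff hm', centredSum, Finset.sum_sub_distrib, Finset.sum_const,
    Finset.card_range, nsmul_eq_mul, sub_eq_zero, mul_comm]

theorem centredSum_length : centredSum g L = 0 := by
  have hL : 1 ≤ L := Nat.one_le_iff_ne_zero.2 (NeZero.ne L)
  rw [← prefixMean_eq_iff g hL le_rfl, prefixMean_length]

theorem centredSum_add_length (s : ℕ) : centredSum g (s + L) = centredSum g s := by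
  rw [add_comm, centredSum, Finset.sum_range_add, ← centredSum, centredSum_length, zero_add,
    centredSum]
  refine Finset.sum_congr rfl fun j _ => ?_
  congr 2
  ext
  simp [Fin.ofNat]

/-- The centred sums are `L`-periodic, so a rotation is good exactly when it starts at a maximum of
them. -/
theorem mem_goodRotations {r : Fin L} : r ∈ goodRotations g ↔
    ∀ m, 1 ≤ m → m ≤ L → centredSum g (r + m) ≤ centredSum g r := by
  simp only [goodRotations, Finset.mem_filter, Finset.mem_univ, true_and]
  refine forall_congr' fun m => ⟨fun h h1 h2 => (prefixMean_rotate_le_iff g r h1 h2).1 (h h1 h2),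
    fun h h1 h2 => (prefixMean_rotate_le_iff g r h1 h2).2 (h h1 h2)⟩

theorem goodRotations_nonempty : (goodRotations g).Nonempty := by
  obtain ⟨r, -, hr⟩ := Finset.exists_max_image (Finset.univ : Finset (Fin L))
    (fun r => centredSum g r) ⟨0, Finset.mem_univ _⟩
  refine ⟨r, (mem_goodRotations g).2 fun m h1 h2 => ?_⟩
  rcases lt_or_ge (r.val + m) L with h | h
  · exact hr ⟨r + m, h⟩ (Finset.mem_univ _)
  · obtain ⟨s, hs⟩ := Nat.exists_eq_add_of_le' h
    rw [hs, centredSum_add_length]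
    exact hr ⟨s, by have := r.isLt; omega⟩ (Finset.mem_univ _)

theorem card_goodRotations_rotate (r : Fin L) :
    (goodRotations fun j => g (j - r)).card = (goodRotations g).card := by
  refine Finset.card_equiv (Equiv.subRight r) fun s => ?_
  have h : mean (fun j => g (j - r)) = mean g := by
    simpa [sub_eq_add_neg] using mean_rotate g (-r)
  simp only [goodRotations, Finset.mem_filter, Finset.mem_univ, true_and, h, Equiv.subRight_apply,
    add_sub_assoc]

theorem card_goodRotations (hg : ∀ m, 1 ≤ m → m ≤ L → prefixMean g m ≤ mean g) :
    (goodRotations g).card =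
      Finset.card {m ∈ Finset.Icc 1 L | prefixMean g m = mean g} := by
  have hL : 1 ≤ L := Nat.one_le_iff_ne_zero.2 (NeZero.ne L)
  have h0 : centredSum g 0 = 0 := by simp [centredSum]
  have hle : ∀ m, m ≤ L → centredSum g m ≤ 0 := by
    intro m hm
    rcases Nat.eq_zero_or_pos m with rfl | h
    · rw [h0]
    · exact (prefixMean_le_iff g h hm).1 (hg m h hm)
  have hmem : ∀ r : Fin L, r ∈ goodRotations g ↔ centredSum g r = 0 := by
    intro r
    rw [mem_goodRotations]
    have hr := r.isLt
    constructor
    · intro h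
      refine le_antisymm (hle _ hr.le) ?_
      have := h (L - r) (by omega) (by omega)
      rwa [show r.val + (L - r.val) = L by omega, centredSum_length] at this
    · intro h m h1 h2
      rw [h]
      rcases le_total (r.val + m) L with h3 | h3
      · exact hle _ h3
      · obtain ⟨s, hs⟩ := Nat.exists_eq_add_of_le' h3
        rw [hs, centredSum_add_length]
        exact hle _ (by omega)
  -- Good rotations are the zeros of the centred sum in `0, …, L - 1`, whereas touches are counted
  -- in `1, …, L`; periodicity matches `0` with `L`.
  refine Finset.card_bij (fun r _ => if r.val = 0 then L else r.val) ?_ ?_ ?_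
  · intro r hr
    rw [hmem] at hr
    have := r.isLt
    rw [Finset.mem_filter, Finset.mem_Icc]
    split_ifs with h
    · exact ⟨⟨hL, le_rfl⟩, prefixMean_length g⟩
    · exact ⟨⟨by omega, by omega⟩, (prefixMean_eq_iff g (by omega) (by omega)).2 hr⟩
  · intro r _ r' _ h
    have := r.isLt
    have := r'.isLt
    ext
    split_ifs at h <;> omega
  · intro m hm
    rw [Finset.mem_filter, Finset.mem_Icc] at hm
    obtain ⟨⟨h1, h2⟩, h3⟩ := hm
    rcases h2.eq_or_lt with rfl | h2
    · refine ⟨⟨0, by omega⟩, (hmem _).2 h0, by simp⟩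
    · refine ⟨⟨m, h2⟩, (hmem _).2 ((prefixMean_eq_iff g h1 h2.le).1 h3), ?_⟩
      simp only
      rw [if_neg (by omega)]

end Rotation

/-! ### Consecutive blocks -/

section Layout

variable {n k : ℕ} (f : Fin k → ℕ)

/-- The number of positions before the `i`-th of consecutive blocks of lengths `f 0, f 1, …`. -/
def blockStart (i : Fin k) : ℕ := ∑ l : Fin k with l < i, f l

theorem blockStart_succ {k : ℕ} (f : Fin (k + 1) → ℕ) (i : Fin k) :
    blockStart f i.succ = f 0 + blockStart (fun l => f l.succ) i := by
  simp [blockStart, Finset.sum_filter, Fin.sum_univ_succ]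

theorem blockStart_add_le {i i' : Fin k} (h : i < i') :
    blockStart f i + f i ≤ blockStart f i' := by
  rw [blockStart, blockStart, add_comm, ← Finset.sum_insert (by simp)]
  refine Finset.sum_le_sum_of_subset fun l hl => ?_
  simp only [Finset.mem_insert, Finset.mem_filter, Finset.mem_univ, true_and] at hl ⊢
  rcases hl with rfl | hl
  · exact h
  · exact hl.trans h

theorem blocksFrom_ofFn {k : ℕ} (f : Fin k → ℕ) (u : ℕ) :
    blocksFrom u (List.ofFn f) = List.ofFn fun i => (u + blockStart f i, f i) := by
  induction k generalizing u with
  | zero => simp [blocksFrom]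
  | succ k ih =>
    rw [List.ofFn_succ, blocksFrom, ih, List.ofFn_succ]
    congr 1
    · simp [blockStart]
    · simp only [blockStart_succ, add_assoc]

variable {f}

/-- The position of the `j`-th element of the `i`-th of consecutive blocks. -/
def layout (h : ∑ i, f i = n) : (Σ i, Fin (f i)) ≃ Fin n :=
  finSigmaFinEquiv.trans (finCongr h)

theorem layout_val (h : ∑ i, f i = n) (i : Fin k) (j : Fin (f i)) :
    (layout h ⟨i, j⟩).val = blockStart f i + j := by
  rw [layout, Equiv.trans_apply, finCongr_apply, Fin.val_cast, finSigmaFinEquiv_apply, blockStart]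
  congr 1
  refine Finset.sum_bij (fun l _ => Fin.castLE i.2.le l) ?_ ?_ ?_ (fun _ _ => rfl)
  · intro l _
    exact Finset.mem_filter.2 ⟨Finset.mem_univ _, Fin.lt_def.2 l.isLt⟩
  · intro l _ l' _ hl
    simpa using hl
  · intro l hl
    simp only [Finset.mem_filter, Finset.mem_univ, true_and] at hl
    exact ⟨⟨l, hl⟩, Finset.mem_univ _, rfl⟩

theorem blockStart_add_le_sum (h : ∑ i, f i = n) (i : Fin k) : blockStart f i + f i ≤ n := by
  rw [blockStart, add_comm, ← Finset.sum_insert (by simp), ← h]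
  exact Finset.sum_le_sum_of_subset (Finset.subset_univ _)

theorem exists_layout (h : ∑ i, f i = n) (a : Fin n) :
    ∃ (i : Fin k) (j : Fin (f i)), a = layout h ⟨i, j⟩ :=
  ⟨_, _, ((layout h).apply_symm_apply a).symm⟩

theorem le_of_layout_le (h : ∑ i, f i = n) {i i' : Fin k} {j : Fin (f i)} {j' : Fin (f i')}
    (hle : layout h ⟨i, j⟩ ≤ layout h ⟨i', j'⟩) : i ≤ i' := by
  by_contra hlt
  rw [Fin.le_def, layout_val, layout_val] at hle
  have := blockStart_add_le f (not_le.1 hlt)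
  have := j'.isLt
  omega

theorem segMean_layout (h : ∑ i, f i = n) (y : Fin n → ℝ) (i : Fin k) {m : ℕ} (hm : m ≤ f i) :
    segMean y (blockStart f i) m = prefixMean (fun j => y (layout h ⟨i, j⟩)) m := by
  rw [segMean, prefixMean]
  congr 1
  symm
  refine Finset.sum_bij (fun j _ => layout h ⟨i, j⟩) ?_ ?_ ?_ (fun _ _ => rfl)
  · intro j hj
    simp only [Finset.mem_filter, Finset.mem_univ, true_and, layout_val] at hj ⊢
    omega
  · intro j _ j' _ hj
    simpa using hj
  · intro a ha
    simp only [Finset.mem_filter, Finset.mem_univ, true_and] at ha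
    refine ⟨⟨a - blockStart f i, by omega⟩, ?_, ?_⟩
    · simp only [Finset.mem_filter, Finset.mem_univ, true_and]
      omega
    · ext
      rw [layout_val]
      simp only
      omega

end Layout

/-! ### Arrangements of blocks -/

section Arrangement

variable {n : ℕ} (p : Nat.Partition n) (τ : Equiv.Perm (Fin (numBlocks p)))

theorem blockLen_pos (i : Fin (numBlocks p)) : 0 < blockLen p i := by
  apply p.parts_pos
  rw [← coe_lengths]
  exact List.get_mem _ _

instance instNeZeroBlockLen (i : Fin (numBlocks p)) : NeZero (blockLen p i) :=
  ⟨(blockLen_pos p i).ne'⟩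

theorem sum_blockLen : ∑ i, blockLen p i = n := by
  rw [← List.sum_ofFn, ofFn_blockLen, ← Multiset.sum_coe, coe_lengths, p.parts_sum]

theorem sum_blockLen_perm : ∑ i, blockLen p (τ i) = n := by
  rw [Equiv.sum_comp τ (blockLen p), sum_blockLen]

/-- The permutation that lays out the blocks in the order `τ`, the block with label `l` being
shifted cyclically by `r l`. -/
noncomputable def arrange (r : ∀ l, Fin (blockLen p l)) : Equiv.Perm (Fin n) :=
  (layout (sum_blockLen_perm p τ)).symm.trans
    ((Equiv.sigmaCongrLeft (β := fun l => Fin (blockLen p l)) τ).trans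
      ((Equiv.sigmaCongrRight fun l => Equiv.addRight (r l)).trans (layout (sum_blockLen p))))

theorem arrange_layout (r : ∀ l, Fin (blockLen p l)) (i : Fin (numBlocks p))
    (j : Fin (blockLen p (τ i))) :
    arrange p τ r (layout (sum_blockLen_perm p τ) ⟨i, j⟩) =
      layout (sum_blockLen p) ⟨τ i, j + r (τ i)⟩ := by
  simp only [arrange, Equiv.trans_apply, Equiv.symm_apply_apply]
  rfl

theorem isArrangement_arrange (r : ∀ l, Fin (blockLen p l)) :
    IsArrangement p τ (arrange p τ r) := by
  refine ⟨fun i => (r (τ i)).val, fun i j hj a ha => ?_⟩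
  obtain rfl : a = layout (sum_blockLen_perm p τ) ⟨i, ⟨j, hj⟩⟩ := by
    ext
    rw [layout_val, ha]
    rfl
  rw [arrange_layout, layout_val, Fin.val_add]
  push_cast
  rfl

theorem exists_arrange {σ : Equiv.Perm (Fin n)} (h : IsArrangement p τ σ) :
    ∃ r, σ = arrange p τ r := by
  obtain ⟨s, hs⟩ := h
  have hpos : ∀ l, (0 : ℤ) < blockLen p l := fun l => by exact_mod_cast blockLen_pos p l
  -- The integer shifts are indexed by place and those of `arrange` by label, hence `τ.symm`.
  refine ⟨fun l => ⟨(s (τ.symm l) % blockLen p l).toNat, ?_⟩, ?_⟩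
  · have := Int.emod_lt_of_pos (s (τ.symm l)) (hpos l)
    have := Int.emod_nonneg (s (τ.symm l)) (hpos l).ne'
    omega
  · ext a
    obtain ⟨i, j, rfl⟩ := exists_layout (sum_blockLen_perm p τ) a
    rw [arrange_layout, layout_val, Fin.val_add]
    have h1 := hs i j j.isLt _ (layout_val (sum_blockLen_perm p τ) i j)
    zify
    rw [h1]
    have := Int.emod_nonneg (s i) (hpos (τ i)).ne'
    simp only [Equiv.symm_apply_apply, Int.toNat_of_nonneg this, Int.add_emod_emod]
    rfl

variable {p τ}

/-- The block containing the image of a position determines the label at that position. Hence `τ'⁻¹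
* τ` preserves the left-to-right order of blocks, and an increasing permutation of `Fin k` is the
identity. -/
theorem arrange_order_injective {τ' : Equiv.Perm (Fin (numBlocks p))}
    {r r' : ∀ l, Fin (blockLen p l)} (h : arrange p τ r = arrange p τ' r') : τ = τ' := by
  have hplace : ∀ i (j : Fin (blockLen p (τ i))), ∃ j' : Fin (blockLen p (τ' (τ'⁻¹ (τ i)))),
      layout (sum_blockLen_perm p τ) ⟨i, j⟩ =
        layout (sum_blockLen_perm p τ') ⟨τ'⁻¹ (τ i), j'⟩ := by
    intro i j
    obtain ⟨i', j', hij⟩ := exists_layout (sum_blockLen_perm p τ')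
      (layout (sum_blockLen_perm p τ) ⟨i, j⟩)
    have h1 := arrange_layout p τ r i j
    rw [hij, h, arrange_layout] at h1
    have h2 : τ' i' = τ i := congrArg Sigma.fst ((layout (sum_blockLen p)).injective h1)
    obtain rfl : i' = τ'⁻¹ (τ i) := by rw [← h2]; simp
    exact ⟨j', hij⟩
  have hmono : Monotone (fun i => τ'⁻¹ (τ i)) := by
    intro i i' hi
    rcases hi.eq_or_lt with rfl | hi
    · exact le_rfl
    obtain ⟨j, hj⟩ := hplace i 0
    obtain ⟨j', hj'⟩ := hplace i' 0
    refine le_of_layout_le (sum_blockLen_perm p τ') (j := j) (j' := j') ?_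
    rw [← hj, ← hj', Fin.le_def, layout_val, layout_val, Fin.val_zero, Fin.val_zero]
    have := blockStart_add_le (fun i => blockLen p (τ i)) hi
    omega
  have hstrict : StrictMono (τ'⁻¹ * τ) :=
    hmono.strictMono_of_injective (τ'⁻¹ * τ).injective
  have hid : ((τ'⁻¹ * τ : Equiv.Perm (Fin (numBlocks p))) : Fin (numBlocks p) → _) = id :=
    (hstrict.range_inj strictMono_id).1 (by
      rw [Set.range_id, (τ'⁻¹ * τ).surjective.range_eq])
  have : τ'⁻¹ * τ = 1 := Equiv.ext (congrFun hid)
  rw [inv_mul_eq_one] at this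
  exact this.symm

theorem arrange_shift_injective {r r' : ∀ l, Fin (blockLen p l)}
    (h : arrange p τ r = arrange p τ r') : r = r' := by
  have h1 : ∀ i, r (τ i) = r' (τ i) := by
    intro i
    have h2 := arrange_layout p τ r i 0
    rw [h, arrange_layout] at h2
    have h3 := (layout (sum_blockLen p)).injective h2
    simpa using h3.symm
  funext l
  obtain ⟨i, rfl⟩ := τ.surjective l
  exact h1 i

variable (p) in
theorem arrange_injective : Function.Injective
    fun x : Equiv.Perm (Fin (numBlocks p)) × (∀ l, Fin (blockLen p l)) => arrange p x.1 x.2 := by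
  rintro ⟨τ, r⟩ ⟨τ', r'⟩ h
  obtain rfl := arrange_order_injective h
  obtain rfl := arrange_shift_injective h
  rfl

variable (p τ)

/-- The restriction of a sequence to the block with label `l`. -/
def blockSeq (x : Fin n → ℝ) (l : Fin (numBlocks p)) (j : Fin (blockLen p l)) : ℝ :=
  x (layout (sum_blockLen p) ⟨l, j⟩)

/-- The restriction of a sequence to the block in the `i`-th place. -/
def placeSeq (y : Fin n → ℝ) (i : Fin (numBlocks p)) (j : Fin (blockLen p (τ i))) : ℝ :=
  y (layout (sum_blockLen_perm p τ) ⟨i, j⟩)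

theorem segMean_start (y : Fin n → ℝ) (i : Fin (numBlocks p)) {m : ℕ}
    (hm : m ≤ blockLen p (τ i)) :
    segMean y (start p τ i) m = prefixMean (placeSeq p τ y i) m :=
  segMean_layout (sum_blockLen_perm p τ) y i hm

theorem segMean_start_blockLen (y : Fin n → ℝ) (i : Fin (numBlocks p)) :
    segMean y (start p τ i) (blockLen p (τ i)) = mean (placeSeq p τ y i) := by
  rw [segMean_start p τ y i le_rfl, prefixMean_length]

theorem placeSeq_comp_arrange (x : Fin n → ℝ) (r : ∀ l, Fin (blockLen p l))
    (i : Fin (numBlocks p)) :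
    placeSeq p τ (x ∘ arrange p τ r) i = fun j => blockSeq p x (τ i) (j + r (τ i)) := by
  funext j
  rw [placeSeq, Function.comp_apply, arrange_layout, blockSeq]

/-- Rotation does not change a block mean, so the conditions decouple: one constrains only `τ`, the
other each shift separately. This makes the admissible set a product. -/
theorem isAdmissible_arrange_iff (x : Fin n → ℝ) (r : ∀ l, Fin (blockLen p l)) :
    IsAdmissible p x τ (arrange p τ r) ↔ Antitone (fun i => mean (blockSeq p x (τ i))) ∧
      ∀ l, r l ∈ goodRotations (blockSeq p x l) := by
  have h1 : ∀ i, segMean (x ∘ arrange p τ r) (start p τ i) (blockLen p (τ i)) =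
      mean (blockSeq p x (τ i)) := by
    intro i
    rw [segMean_start_blockLen, placeSeq_comp_arrange, mean_rotate]
  rw [IsAdmissible, and_iff_right (isArrangement_arrange p τ r)]
  simp only [h1]
  refine and_congr_right fun _ => ?_
  rw [← τ.forall_congr_right (q := fun l => r l ∈ goodRotations (blockSeq p x l))]
  refine forall_congr' fun i => ?_
  simp only [goodRotations, Finset.mem_filter, Finset.mem_univ, true_and]
  refine forall_congr' fun m => forall_congr' fun _ => forall_congr' fun hm => ?_
  rw [segMean_start p τ _ i hm, placeSeq_comp_arrange]

variable {p τ} in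
theorem mem_admissible {x : Fin n → ℝ} {σ : Equiv.Perm (Fin n)} :
    σ ∈ admissible p x ↔ ∃ τ, IsAdmissible p x τ σ := by
  simp [admissible]

theorem arrange_mem_admissible_iff (x : Fin n → ℝ) (r : ∀ l, Fin (blockLen p l)) :
    arrange p τ r ∈ admissible p x ↔ IsAdmissible p x τ (arrange p τ r) := by
  rw [mem_admissible]
  refine ⟨?_, fun h => ⟨τ, h⟩⟩
  rintro ⟨τ', h⟩
  obtain ⟨r', hr'⟩ := exists_arrange p τ' h.1
  obtain rfl := arrange_order_injective hr'
  exact h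

open Classical in
theorem admissible_eq_image (x : Fin n → ℝ) :
    admissible p x = (Finset.univ.filter (fun τ : Equiv.Perm (Fin (numBlocks p)) =>
      Antitone fun i => mean (blockSeq p x (τ i))) ×ˢ
        Fintype.piFinset fun l => goodRotations (blockSeq p x l)).image
          fun z => arrange p z.1 z.2 := by
  ext σ
  simp only [Finset.mem_image, Finset.mem_product, Finset.mem_filter, Finset.mem_univ, true_and,
    Fintype.mem_piFinset, Prod.exists]
  rw [mem_admissible]
  constructor
  · rintro ⟨τ, h⟩
    obtain ⟨r, rfl⟩ := exists_arrange p τ h.1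
    exact ⟨τ, r, (isAdmissible_arrange_iff p τ x r).1 h, rfl⟩
  · rintro ⟨τ, r, h, rfl⟩
    exact ⟨τ, (isAdmissible_arrange_iff p τ x r).2 h⟩

open Classical in
theorem card_admissible (x : Fin n → ℝ) :
    (admissible p x).card = Finset.card {τ : Equiv.Perm (Fin (numBlocks p)) |
      Antitone fun i => mean (blockSeq p x (τ i))} *
        ∏ l, (goodRotations (blockSeq p x l)).card := by
  rw [admissible_eq_image, Finset.card_image_of_injective _ (arrange_injective p),
    Finset.card_product, Fintype.card_piFinset]

theorem admissible_nonempty (x : Fin n → ℝ) : (admissible p x).Nonempty := by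
  choose r hr using fun l => goodRotations_nonempty (blockSeq p x l)
  let τ := Tuple.sort fun l => -mean (blockSeq p x l)
  have hτ : Antitone fun i => mean (blockSeq p x (τ i)) := fun i i' hi =>
    neg_le_neg_iff.1 (Tuple.monotone_sort (fun l => -mean (blockSeq p x l)) hi)
  exact ⟨arrange p τ r, mem_admissible.2 ⟨τ, (isAdmissible_arrange_iff p τ x r).2 ⟨hτ, hr⟩⟩⟩

/-! ### The law of a uniform admissible rearrangement -/

theorem slopes_ofFn (y : Fin n → ℝ) : slopes y 0 (List.ofFn (blockLen p ∘ τ)) =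
    List.ofFn fun i => segMean y (start p τ i) (blockLen p (τ i)) := by
  rw [slopes, blocksFrom_ofFn, List.map_ofFn]
  congr 1
  funext i
  simp only [Function.comp_apply, zero_add]
  rfl

theorem majorantPath_ofFn_iff (y : Fin n → ℝ) :
    MajorantPath y 0 (List.ofFn (blockLen p ∘ τ)) ↔
      Antitone (fun i => segMean y (start p τ i) (blockLen p (τ i))) ∧
      ∀ i, UnderChord y (start p τ i) (blockLen p (τ i)) := by
  rw [MajorantPath, slopes_ofFn, blocksFrom_ofFn]
  refine and_congr ?_ ?_
  · rw [← List.sortedGE_iff_pairwise, List.sortedGE_ofFn_iff]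
  · simp only [List.forall_mem_ofFn_iff, zero_add]
    rfl

theorem isAdmissible_comp_symm_iff (y : Fin n → ℝ) (r : ∀ l, Fin (blockLen p l)) :
    IsAdmissible p (y ∘ (arrange p τ r).symm) τ (arrange p τ r) ↔
      MajorantPath y 0 (List.ofFn (blockLen p ∘ τ)) := by
  have h : (y ∘ (arrange p τ r).symm) ∘ arrange p τ r = y := by
    funext a; simp
  rw [IsAdmissible, and_iff_right (isArrangement_arrange p τ r), h, majorantPath_ofFn_iff]
  rfl

theorem blockSeq_comp_symm (y : Fin n → ℝ) (r : ∀ l, Fin (blockLen p l))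
    (i : Fin (numBlocks p)) :
    blockSeq p (y ∘ (arrange p τ r).symm) (τ i) = fun j => placeSeq p τ y i (j - r (τ i)) := by
  funext j
  rw [blockSeq, placeSeq, Function.comp_apply]
  congr 1
  rw [Equiv.symm_apply_eq, arrange_layout, sub_add_cancel]

open Classical in
-- A non-increasing rearrangement of the means is unique as a sequence, so the allowed orders form a
-- coset of the stabilizer of the slopes. Undoing the shift of a block does not change its number of
-- good rotations, which equals its number of touches because the walk of `y` is under the chord.
theorem card_admissible_comp_symm (y : Fin n → ℝ) (r : ∀ l, Fin (blockLen p l))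
    (h : MajorantPath y 0 (List.ofFn (blockLen p ∘ τ))) :
    ((admissible p (y ∘ (arrange p τ r).symm)).card : ℝ)⁻¹ =
      pathWeight y 0 (List.ofFn (blockLen p ∘ τ)) := by
  obtain ⟨hanti, hchord⟩ := (majorantPath_ofFn_iff p τ y).1 h
  set x := y ∘ (arrange p τ r).symm with hx
  set μ : Fin (numBlocks p) → ℝ := fun l => mean (blockSeq p x l) with hμ
  have hμτ : μ ∘ τ = fun i => segMean y (start p τ i) (blockLen p (τ i)) := by
    funext i
    rw [segMean_start_blockLen, Function.comp_apply, hμ]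
    simp only
    rw [hx, blockSeq_comp_symm]
    simpa [sub_eq_add_neg] using mean_rotate (placeSeq p τ y i) (-r (τ i))
  have h1 : Finset.card {τ' : Equiv.Perm (Fin (numBlocks p)) | Antitone fun i => μ (τ' i)} =
      multFactorial (slopes y 0 (List.ofFn (blockLen p ∘ τ))) := by
    rw [slopes_ofFn, ← hμτ, ← card_stabilizer_eq_multFactorial]
    refine Finset.card_equiv (Equiv.mulLeft τ⁻¹) fun τ' => ?_
    simp only [Finset.mem_filter, Finset.mem_univ, true_and, Equiv.coe_mulLeft]
    have h2 : (μ ∘ τ) ∘ (τ⁻¹ * τ' : Equiv.Perm (Fin (numBlocks p))) = μ ∘ τ' := by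
      funext i; simp
    rw [h2]
    rw [← hμτ] at hanti
    constructor
    · intro h3
      have := Tuple.unique_monotone (f := OrderDual.toDual ∘ μ) (σ := τ') (τ := τ) h3.dual_right
        hanti.dual_right
      exact this
    · intro h3
      have : (fun i => μ (τ' i)) = μ ∘ τ := h3
      rw [this]
      exact hanti
  have h2 : ∏ l, (goodRotations (blockSeq p x l)).card =
      ((blocksFrom 0 (List.ofFn (blockLen p ∘ τ))).map fun b => touchCount y b.1 b.2).prod := by
    rw [blocksFrom_ofFn, List.map_ofFn, List.prod_ofFn, ← Equiv.prod_comp τ]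
    refine Finset.prod_congr rfl fun i _ => ?_
    rw [hx, blockSeq_comp_symm, card_goodRotations_rotate, card_goodRotations]
    · simp only [Function.comp_apply, zero_add]
      refine congrArg Finset.card (Finset.filter_congr fun m hm => ?_)
      change _ ↔ segMean y (start p τ i) m = segMean y (start p τ i) (blockLen p (τ i))
      rw [segMean_start_blockLen, segMean_start p τ y i (Finset.mem_Icc.1 hm).2]
    · intro m h1 h2
      rw [← segMean_start p τ y i h2, ← segMean_start_blockLen]
      exact hchord i m h1 h2
  rw [card_admissible, h1, h2, pathWeight]
  push_cast
  congr 2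
  rw [List.map_map]
  rfl

open Classical in
-- The summand at `arrange p τ r` depends only on `τ`, and there are as many `r` as the product of
-- the block lengths.
theorem sum_admissible_comp_symm (y : Fin n → ℝ) :
    ∑ σ : Equiv.Perm (Fin n), (if σ ∈ admissible p (y ∘ σ.symm)
      then 1 / ((admissible p (y ∘ σ.symm)).card : ℝ) else 0) =
    (lengths p).prod * ∑ τ : Equiv.Perm (Fin (numBlocks p)),
      if MajorantPath y 0 (List.ofFn (blockLen p ∘ τ))
        then pathWeight y 0 (List.ofFn (blockLen p ∘ τ)) else 0 := by
  have h1 : ∀ σ ∉ Finset.univ.image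
      (fun x : Equiv.Perm (Fin (numBlocks p)) × (∀ l, Fin (blockLen p l)) => arrange p x.1 x.2),
      (if σ ∈ admissible p (y ∘ σ.symm)
      then 1 / ((admissible p (y ∘ σ.symm)).card : ℝ) else 0) = 0 := by
    intro σ hσ
    refine if_neg fun h => hσ ?_
    obtain ⟨τ, h⟩ := mem_admissible.1 h
    obtain ⟨r, hr⟩ := exists_arrange p τ h.1
    exact Finset.mem_image.2 ⟨(τ, r), Finset.mem_univ _, hr.symm⟩
  rw [← Finset.sum_subset (Finset.subset_univ _) fun σ _ h => h1 σ h,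
    Finset.sum_image fun _ _ _ _ h => arrange_injective p h, Fintype.sum_prod_type, Finset.mul_sum]
  refine Finset.sum_congr rfl fun τ _ => ?_
  rw [← ofFn_blockLen, List.prod_ofFn]
  have h2 : ∀ r : ∀ l, Fin (blockLen p l),
      (if arrange p τ r ∈ admissible p (y ∘ (arrange p τ r).symm)
      then 1 / ((admissible p (y ∘ (arrange p τ r).symm)).card : ℝ) else 0) =
      if MajorantPath y 0 (List.ofFn (blockLen p ∘ τ))
        then pathWeight y 0 (List.ofFn (blockLen p ∘ τ)) else 0 := by
    intro r
    refine if_ctx_congr (by rw [arrange_mem_admissible_iff, isAdmissible_comp_symm_iff])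
      (fun h => ?_) (fun _ => rfl)
    rw [one_div, card_admissible_comp_symm p τ y r h]
  simp only [h2, Finset.sum_const, Finset.card_univ, Fintype.card_pi, Fintype.card_fin,
    nsmul_eq_mul]

/-- The probability that the cycle lengths of a uniform permutation are the parts of `p`. -/
noncomputable def cycleProb : ℝ :=
  (Finset.card {π : Equiv.Perm (Fin n) | π.partition.parts = p.parts} : ℝ) / n.factorial

theorem cycleProb_mul_prod :
    cycleProb p * (lengths p).prod = (multFactorial (lengths p) : ℝ)⁻¹ := by
  have h := card_partition_mul_eq_factorial p
  have h1 := multFactorial_pos (lengths p)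
  have h2 := n.factorial_pos
  rw [cycleProb, ← h]
  rw [← h] at h2
  have h3 := Nat.pos_of_mul_pos_right h2
  have h4 := Nat.pos_of_mul_pos_left h2
  have h5 := Nat.pos_of_mul_pos_right h4
  rw [Nat.cast_mul, Nat.cast_mul]
  generalize (lengths p).prod = a at *
  field_simp

open Classical in
theorem sum_cycleProb_mul_sum_admissible (y : Fin n → ℝ) :
    ∑ p : Nat.Partition n, cycleProb p * ∑ σ : Equiv.Perm (Fin n),
      (if σ ∈ admissible p (y ∘ σ.symm)
        then 1 / ((admissible p (y ∘ σ.symm)).card : ℝ) else 0) = 1 := by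
  simp_rw [sum_admissible_comp_symm, ← mul_assoc, cycleProb_mul_prod]
  rw [sum_partition_sum_perm fun c => if MajorantPath y 0 c then pathWeight y 0 c else 0,
    ← Finset.sum_filter, sum_pathWeight]

end Arrangement

/-! ### The concave majorant -/

section Majorant

variable {n : ℕ} (p : Nat.Partition n) (τ : Equiv.Perm (Fin (numBlocks p))) (y : Fin n → ℝ)

/-- The slope over the block in the `i`-th place. -/
noncomputable def placeSlope (i : Fin (numBlocks p)) : ℝ :=
  segMean y (start p τ i) (blockLen p (τ i))

/-- The line through the ends of the walk over the block in the `i`-th place. -/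
noncomputable def chordLine (i : Fin (numBlocks p)) (t : ℝ) : ℝ :=
  walk y (start p τ i) + (t - start p τ i) * placeSlope p τ y i

theorem walk_start (i : Fin (numBlocks p)) :
    walk y (start p τ i) = ∑ l with l < i, blockLen p (τ l) * placeSlope p τ y l := by
  have h := sum_blockLen_perm p τ
  rw [walk, Finset.sum_filter, ← Equiv.sum_comp (layout h), Fintype.sum_sigma, Finset.sum_filter]
  refine Finset.sum_congr rfl fun l _ => ?_
  split_ifs with hl
  · have h1 : (blockLen p (τ l) : ℝ) ≠ 0 := by exact_mod_cast (blockLen_pos p (τ l)).ne'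
    rw [placeSlope, segMean_start_blockLen, mean, mul_div_cancel₀ _ h1]
    refine Finset.sum_congr rfl fun j _ => if_pos ?_
    rw [layout_val]
    have := blockStart_add_le (fun i => blockLen p (τ i)) hl
    change _ < blockStart (fun i => blockLen p (τ i)) i
    have := j.isLt
    omega
  · refine Finset.sum_eq_zero fun j _ => if_neg fun hlt => ?_
    rw [layout_val] at hlt
    change _ < blockStart (fun i => blockLen p (τ i)) i at hlt
    rcases (not_lt.1 hl).eq_or_lt with rfl | hl
    · omega
    · have := blockStart_add_le (fun i => blockLen p (τ i)) hl
      omega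

variable {τ y}

/-- With non-increasing slopes, the total of length × (slope minus the `i`-th slope) over a set of
blocks is largest for the blocks before `i`. For initial sets `S`, this puts the block endpoints
under every chord line. -/
theorem sum_le_chordLine (hanti : Antitone (placeSlope p τ y))
    (S : Finset (Fin (numBlocks p))) (i : Fin (numBlocks p)) :
    ∑ l ∈ S, blockLen p (τ l) * placeSlope p τ y l ≤
      chordLine p τ y i (∑ l ∈ S, (blockLen p (τ l) : ℝ)) := by
  have h : ∑ l ∈ S, (blockLen p (τ l) : ℝ) * (placeSlope p τ y l - placeSlope p τ y i) ≤
      ∑ l with l < i, (blockLen p (τ l) : ℝ) * (placeSlope p τ y l - placeSlope p τ y i) := by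
    rw [← Finset.sum_filter_add_sum_filter_not S (· < i), ← add_zero (∑ l with l < i, _)]
    refine add_le_add (Finset.sum_le_sum_of_subset_of_nonneg ?_ ?_) (Finset.sum_nonpos ?_)
    · exact Finset.filter_subset_filter _ (Finset.subset_univ _)
    · intro l hl _
      exact mul_nonneg (Nat.cast_nonneg _) (sub_nonneg.2 (hanti (Finset.mem_filter.1 hl).2.le))
    · intro l hl
      exact mul_nonpos_of_nonneg_of_nonpos (Nat.cast_nonneg _)
        (sub_nonpos.2 (hanti (not_lt.1 (Finset.mem_filter.1 hl).2)))
  simp only [mul_sub, Finset.sum_sub_distrib, ← Finset.sum_mul] at h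
  rw [chordLine, walk_start]
  simp only [start]
  push_cast
  linarith

theorem chordLine_le_chordLine (hanti : Antitone (placeSlope p τ y))
    (i i' : Fin (numBlocks p)) {t : ℝ} (h1 : start p τ i ≤ t)
    (h2 : t ≤ start p τ i + blockLen p (τ i)) :
    chordLine p τ y i t ≤ chordLine p τ y i' t := by
  rcases le_total i' i with h | h
  · have h3 := sum_le_chordLine p hanti (Finset.univ.filter (· < i)) i'
    rw [← walk_start, ← Nat.cast_sum, ← start] at h3
    have h4 := mul_le_mul_of_nonneg_left (hanti h) (sub_nonneg.2 h1)
    simp only [chordLine] at h3 ⊢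
    linarith
  · have h3 := sum_le_chordLine p hanti (insert i (Finset.univ.filter (· < i))) i'
    rw [Finset.sum_insert (by simp), Finset.sum_insert (by simp), ← walk_start, ← Nat.cast_sum,
      ← start] at h3
    have h4 := mul_le_mul_of_nonneg_left (hanti h) (sub_nonneg.2 h2)
    simp only [chordLine] at h3 ⊢
    linarith

variable (τ) in
theorem exists_block [Nonempty (Fin (numBlocks p))] {t : ℝ} (h0 : 0 ≤ t) (hn : t ≤ n) :
    ∃ i, (start p τ i : ℝ) ≤ t ∧ t ≤ start p τ i + blockLen p (τ i) := by
  have hpos : 0 < n := by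
    obtain ⟨l⟩ := ‹Nonempty (Fin (numBlocks p))›
    have h1 := blockLen_pos p l
    have h2 := Finset.single_le_sum (f := blockLen p) (fun _ _ => Nat.zero_le _)
      (Finset.mem_univ l)
    rw [sum_blockLen] at h2
    omega
  obtain ⟨i, j, hij⟩ := exists_layout (sum_blockLen_perm p τ)
    -- The minimum places the right end `t = n` in the last block.
    ⟨min ⌊t⌋₊ (n - 1), by omega⟩
  have h1 : min ⌊t⌋₊ (n - 1) = start p τ i + j :=
    (congrArg Fin.val hij).trans (layout_val _ _ _)
  have h2 := j.isLt
  have h3 := Nat.floor_le h0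
  refine ⟨i, ?_, ?_⟩
  · have : start p τ i ≤ ⌊t⌋₊ := by omega
    have : (start p τ i : ℝ) ≤ ⌊t⌋₊ := by exact_mod_cast this
    linarith
  · rcases le_total ⌊t⌋₊ (n - 1) with h | h
    · have h4 := (Nat.lt_floor_add_one t).le
      have : ⌊t⌋₊ + 1 ≤ start p τ i + blockLen p (τ i) := by omega
      have : (⌊t⌋₊ : ℝ) + 1 ≤ start p τ i + blockLen p (τ i) := by exact_mod_cast this
      linarith
    · have : n ≤ start p τ i + blockLen p (τ i) := by omega
      have : (n : ℝ) ≤ start p τ i + blockLen p (τ i) := by exact_mod_cast this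
      linarith

theorem exists_isConcaveMajorant (hanti : Antitone (placeSlope p τ y))
    (hchord : ∀ i, UnderChord y (start p τ i) (blockLen p (τ i))) :
    ∃ C : ℝ → ℝ, IsConcaveMajorant n (walk y) C ∧
      ∀ i, ∀ t ∈ Set.Icc (start p τ i : ℝ) (start p τ i + blockLen p (τ i)),
        C t = chordLine p τ y i t := by
  -- Without blocks `n = 0`, and there are no lines to take the infimum of.
  rcases isEmpty_or_nonempty (Fin (numBlocks p)) with hk | hk
  · have hn : n = 0 := by rw [← sum_blockLen p, Finset.univ_eq_empty, Finset.sum_empty]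
    subst hn
    have hw : ∀ j, walk y j = 0 := fun j => by simp [walk]
    refine ⟨fun _ => 0, ⟨⟨concaveOn_const _ (convex_Icc _ _), fun j _ => (hw j).le⟩,
      fun D _ hD t ht => ?_⟩, fun i => hk.elim i⟩
    obtain rfl : t = 0 := by simpa using ht
    simpa [hw] using hD 0 le_rfl
  have hC : ∀ i, ∀ t ∈ Set.Icc (start p τ i : ℝ) (start p τ i + blockLen p (τ i)),
      ⨅ i, chordLine p τ y i t = chordLine p τ y i t := fun i t ht =>
    le_antisymm (ciInf_le (Set.finite_range _).bddBelow i)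
      (le_ciInf fun i' => chordLine_le_chordLine p hanti i i' ht.1 ht.2)
  have hend : ∀ i, walk y (start p τ i + blockLen p (τ i)) =
      walk y (start p τ i) + blockLen p (τ i) * placeSlope p τ y i := fun i => walk_add _ _ _
  refine ⟨fun t => ⨅ i, chordLine p τ y i t, ⟨⟨⟨convex_Icc _ _, ?_⟩, ?_⟩, ?_⟩, hC⟩
  · intro s _ t _ a b ha hb hab
    refine le_ciInf fun i => ?_
    have h1 : ⨅ i, chordLine p τ y i s ≤ chordLine p τ y i s :=
      ciInf_le (Set.finite_range _).bddBelow i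
    have h2 : ⨅ i, chordLine p τ y i t ≤ chordLine p τ y i t :=
      ciInf_le (Set.finite_range _).bddBelow i
    have h3 : chordLine p τ y i (a • s + b • t) =
        a * chordLine p τ y i s + b * chordLine p τ y i t := by
      obtain rfl : b = 1 - a := by linarith
      simp only [chordLine, smul_eq_mul]
      ring
    rw [h3]
    exact add_le_add (mul_le_mul_of_nonneg_left h1 ha) (mul_le_mul_of_nonneg_left h2 hb)
  · intro j hj
    obtain ⟨i, h1, h2⟩ := exists_block p τ (t := j) (Nat.cast_nonneg _) (by exact_mod_cast hj)
    beta_reduce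
    rw [hC i j ⟨h1, h2⟩]
    have h1' : start p τ i ≤ j := by exact_mod_cast h1
    have h2' : j ≤ start p τ i + blockLen p (τ i) := by exact_mod_cast h2
    obtain ⟨m, rfl⟩ := Nat.exists_eq_add_of_le h1'
    rw [chordLine]
    push_cast
    rw [add_sub_cancel_left]
    rcases Nat.eq_zero_or_pos m with rfl | hm
    · simp
    · exact (segMean_le_iff y _ hm _).1 (hchord i m hm (by omega))
  · intro D hD hdom t ht
    obtain ⟨i, h1, h2⟩ := exists_block p τ ht.1 ht.2
    beta_reduce
    rw [hC i t ⟨h1, h2⟩]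
    have hb : (0 : ℝ) < blockLen p (τ i) := by exact_mod_cast blockLen_pos p (τ i)
    have hle : start p τ i + blockLen p (τ i) ≤ n :=
      blockStart_add_le_sum (sum_blockLen_perm p τ) i
    have hle' : (start p τ i : ℝ) + blockLen p (τ i) ≤ n := by exact_mod_cast hle
    have hs : (0 : ℝ) ≤ start p τ i := Nat.cast_nonneg _
    have hd1 := hdom (start p τ i) (by omega)
    have hd2 := hdom _ hle
    rw [hend] at hd2
    push_cast at hd2
    set θ : ℝ := (t - start p τ i) / blockLen p (τ i) with hθ
    have hθb : θ * blockLen p (τ i) = t - start p τ i := div_mul_cancel₀ _ hb.ne'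
    have hθ0 : 0 ≤ θ := div_nonneg (sub_nonneg.2 h1) hb.le
    have hθ1 : θ ≤ 1 := (div_le_one hb).2 (by linarith)
    have hl : (start p τ i : ℝ) ∈ Set.Icc 0 (n : ℝ) := ⟨hs, by linarith⟩
    have hr : (start p τ i + blockLen p (τ i) : ℝ) ∈ Set.Icc 0 (n : ℝ) := ⟨by linarith, hle'⟩
    have := hD.2 hl hr (sub_nonneg.2 hθ1) hθ0 (sub_add_cancel 1 θ)
    simp only [smul_eq_mul] at this
    rw [show (1 - θ) * (start p τ i : ℝ) + θ * (start p τ i + blockLen p (τ i)) = t by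
      linarith] at this
    refine le_trans ?_ this
    rw [chordLine, ← hθb]
    have e1 := mul_le_mul_of_nonneg_left hd1 (show 0 ≤ 1 - θ by linarith)
    have e2 := mul_le_mul_of_nonneg_left hd2 hθ0
    linarith

end Majorant

/-! ### Measurability -/

section Measurability

variable {n : ℕ} (p : Nat.Partition n)

open Classical in
/-- The probability of `σ` under the uniform distribution on the admissible rearrangements. -/
noncomputable def admissibleProb (σ : Equiv.Perm (Fin n)) (p : Nat.Partition n)
    (x : Fin n → ℝ) : ℝ :=
  if σ ∈ admissible p x then 1 / ((admissible p x).card : ℝ) else 0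

theorem admissibleProb_nonneg (σ : Equiv.Perm (Fin n)) (x : Fin n → ℝ) :
    0 ≤ admissibleProb σ p x := by
  rw [admissibleProb]
  split_ifs <;> positivity

theorem admissibleProb_le_one (σ : Equiv.Perm (Fin n)) (x : Fin n → ℝ) :
    admissibleProb σ p x ≤ 1 := by
  rw [admissibleProb]
  split_ifs with h
  · have : (1 : ℝ) ≤ (admissible p x).card := by exact_mod_cast Finset.card_pos.2 ⟨σ, h⟩
    exact div_le_one_of_le₀ this (by positivity)
  · exact zero_le_one

theorem measurable_segMean_comp (σ : Equiv.Perm (Fin n)) (s m : ℕ) :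
    Measurable fun x : Fin n → ℝ => segMean (x ∘ σ) s m := by
  simp only [segMean, Function.comp_apply]
  fun_prop

theorem measurableSet_mem_admissible (σ : Equiv.Perm (Fin n)) :
    MeasurableSet {x : Fin n → ℝ | σ ∈ admissible p x} := by
  simp only [mem_admissible, IsAdmissible, Antitone, Set.ofPred_exists, Set.ofPred_and,
    Set.ofPred_forall]
  refine MeasurableSet.iUnion fun τ => (MeasurableSet.const _).inter (MeasurableSet.inter ?_ ?_)
  · refine MeasurableSet.iInter fun i => MeasurableSet.iInter fun i' => MeasurableSet.iInter
      fun _ => measurableSet_le (measurable_segMean_comp σ _ _) (measurable_segMean_comp σ _ _)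
  · refine MeasurableSet.iInter fun i => MeasurableSet.iInter fun m => MeasurableSet.iInter
      fun _ => MeasurableSet.iInter fun _ =>
        measurableSet_le (measurable_segMean_comp σ _ _) (measurable_segMean_comp σ _ _)

theorem measurable_admissibleProb (σ : Equiv.Perm (Fin n)) :
    Measurable (admissibleProb σ p) := by
  classical
  have hcard : Measurable fun x : Fin n → ℝ => ((admissible p x).card : ℝ) := by
    have : (fun x : Fin n → ℝ => ((admissible p x).card : ℝ)) =
        fun x => ∑ σ, if σ ∈ admissible p x then (1 : ℝ) else 0 := by
      funext x
      simp
    rw [this]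
    exact Finset.measurable_fun_sum _ fun σ _ =>
      Measurable.ite (measurableSet_mem_admissible p σ) measurable_const measurable_const
  exact Measurable.ite (measurableSet_mem_admissible p σ) (measurable_const.div hcard)
    measurable_const

theorem measurable_walk (j : ℕ) : Measurable fun x : Fin n → ℝ => walk x j := by
  simp only [walk]
  fun_prop

end Measurability

/-! ### The law of the rearranged walk -/

section Law

variable {n : ℕ} {Ω : Type*} [MeasurableSpace Ω] {μ : Measure Ω} [IsProbabilityMeasure μ]
  {X : Ω → Fin n → ℝ} {L : Ω → Nat.Partition n} {ρ : Ω → Equiv.Perm (Fin n)}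

theorem measureReal_inter_eq_setIntegral (hX : Measurable X) (hL : Measurable L)
    (hρ : Measurable ρ) (hunif : IsUniformAdmissible μ X L ρ) (σ : Equiv.Perm (Fin n))
    {T : Set ((Fin n → ℝ) × Nat.Partition n)} (hT : MeasurableSet T) :
    μ.real ({ω | ρ ω = σ} ∩ {ω | (X ω, L ω) ∈ T}) =
      ∫ ω in {ω | (X ω, L ω) ∈ T}, admissibleProb σ (L ω) (X ω) ∂μ := by
  have hm := (hX.prodMk hL).comap_le
  have hE : MeasurableSet {ω | ρ ω = σ} := hρ (MeasurableSpace.measurableSet_top (s := {σ}))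
  have hS : MeasurableSet {ω | (X ω, L ω) ∈ T} := (hX.prodMk hL) hT
  have h1 := setIntegral_condExp (μ := μ) hm
    ((integrable_const (1 : ℝ)).indicator hE) ⟨T, hT, rfl⟩
  rw [setIntegral_indicator (μ := μ) hE, setIntegral_const, smul_eq_mul, mul_one, Set.inter_comm] at h1
  refine h1.symm.trans (setIntegral_congr_ae hS ?_)
  filter_upwards [hunif σ] with ω hω _
  rw [admissibleProb]
  exact hω

/-- On the event that `σ` is not admissible the conditional probability of `ρ = σ` vanishes, and
there are finitely many `σ`. -/
theorem ae_mem_admissible (hX : Measurable X) (hL : Measurable L)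
    (hρ : Measurable ρ) (hunif : IsUniformAdmissible μ X L ρ) :
    ∀ᵐ ω ∂μ, ρ ω ∈ admissible (L ω) (X ω) := by
  have h : ∀ σ, ∀ᵐ ω ∂μ, ρ ω = σ → σ ∈ admissible (L ω) (X ω) := by
    intro σ
    have hT : MeasurableSet {z : (Fin n → ℝ) × Nat.Partition n | σ ∉ admissible z.2 z.1} := by
      have : {z : (Fin n → ℝ) × Nat.Partition n | σ ∉ admissible z.2 z.1} =
          ⋃ p, {x | σ ∈ admissible p x}ᶜ ×ˢ {p} := by
        ext z
        simp
      rw [this]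
      exact MeasurableSet.iUnion fun p =>
        (measurableSet_mem_admissible p σ).compl.prod MeasurableSpace.measurableSet_top
    have h1 := measureReal_inter_eq_setIntegral hX hL hρ hunif σ hT
    rw [setIntegral_eq_zero_of_forall_eq_zero, measureReal_eq_zero_iff] at h1
    · rw [ae_iff]
      convert h1 using 2
      ext ω
      simp
    · intro ω hω
      exact if_neg hω
  filter_upwards [ae_all_iff.2 h] with ω hω
  exact hω _ rfl

theorem integral_indicator_mul_admissibleProb (hX : Measurable X) (hL : Measurable L)
    (hexch : Exchangeable μ X) (hindep : IndepFun X L μ) {A : Set (Fin n → ℝ)}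
    (hA : MeasurableSet A) (σ : Equiv.Perm (Fin n)) :
    ∫ ω, (A.indicator 1 (X ω ∘ σ) : ℝ) * admissibleProb σ (L ω) (X ω) ∂μ =
      ∑ p, μ.real {ω | L ω = p} *
        ∫ ω, (A.indicator 1 (X ω) : ℝ) * admissibleProb σ p (X ω ∘ σ.symm) ∂μ := by
  classical
  have hcomp : ∀ π : Equiv.Perm (Fin n), Measurable fun x : Fin n → ℝ => x ∘ π := fun π =>
    measurable_pi_lambda _ fun a => measurable_pi_apply (π a)
  have hind : Measurable (A.indicator 1 : (Fin n → ℝ) → ℝ) := measurable_one.indicator hA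
  have hind1 : ∀ x, ‖(A.indicator 1 x : ℝ)‖ ≤ 1 := fun x => by
    by_cases h : x ∈ A <;> simp [h]
  let φ : Nat.Partition n → (Fin n → ℝ) → ℝ := fun p x =>
    A.indicator 1 (x ∘ σ) * admissibleProb σ p x
  let ψ : Nat.Partition n → Nat.Partition n → ℝ := fun p q => if q = p then 1 else 0
  have hφ : ∀ p, Measurable (φ p) := fun p =>
    (hind.comp (hcomp σ)).mul (measurable_admissibleProb p σ)
  have hψ : ∀ p, Measurable (ψ p) := fun p => measurable_from_top
  have hφ1 : ∀ p x, ‖φ p x‖ ≤ 1 := by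
    intro p x
    rw [norm_mul]
    refine mul_le_one₀ (hind1 _) (norm_nonneg _) ?_
    rw [Real.norm_of_nonneg (admissibleProb_nonneg p σ x)]
    exact admissibleProb_le_one p σ x
  have hψ1 : ∀ p q, ‖ψ p q‖ ≤ 1 := fun p q => by
    by_cases h : q = p <;> simp [ψ, h]
  have hsum : ∀ ω, (A.indicator 1 (X ω ∘ σ) : ℝ) * admissibleProb σ (L ω) (X ω) =
      ∑ p, φ p (X ω) * ψ p (L ω) := by
    intro ω
    simp [φ, ψ]
  simp_rw [hsum]
  rw [integral_finsetSum]
  · refine Finset.sum_congr rfl fun p _ => ?_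
    have h1 := (hindep.comp (hφ p) (hψ p)).integral_fun_mul_eq_mul_integral
      ((hφ p).comp hX).aestronglyMeasurable ((hψ p).comp hL).aestronglyMeasurable
    have h2 : ∫ ω, ψ p (L ω) ∂μ = μ.real {ω | L ω = p} := by
      have hE : MeasurableSet {ω | L ω = p} := hL (MeasurableSpace.measurableSet_top (s := {p}))
      rw [← integral_indicator_one hE]
      refine integral_congr_ae (Filter.Eventually.of_forall fun ω => ?_)
      by_cases h : L ω = p <;> simp [ψ, h]
    have hv : Measurable fun x : Fin n → ℝ =>
        (A.indicator 1 x : ℝ) * admissibleProb σ p (x ∘ σ.symm) :=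
      hind.mul ((measurable_admissibleProb p σ).comp (hcomp σ.symm))
    -- Exchangeability is applied to a function of `X ∘ σ` alone: `X` itself is recovered as `(X ∘
    -- σ) ∘ σ.symm`.
    have h3 := ((hexch σ).comp hv).integral_eq
    simp only [Function.comp_apply] at h1
    rw [h1, h2, mul_comm]
    congr 1
    rw [← Function.comp_def] at h3
    refine Eq.trans (integral_congr_ae (Filter.Eventually.of_forall fun ω => ?_)) h3
    simp only [φ, Function.comp_apply]
    congr 2
    funext a
    simp
  · intro p _
    refine Integrable.of_bound (C := 1)
      (((hφ p).comp hX).mul ((hψ p).comp hL)).aestronglyMeasurable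
      (Filter.Eventually.of_forall fun ω => ?_)
    rw [norm_mul]
    exact mul_le_one₀ (hφ1 _ _) (norm_nonneg _) (hψ1 _ _)

/-- A uniform admissible rearrangement of exchangeable increments has the law of the increments. -/
theorem identDistrib_comp_rearrangement (hX : Measurable X) (hL : Measurable L)
    (hρ : Measurable ρ) (hexch : Exchangeable μ X) (hindep : IndepFun X L μ)
    (hcycle : HasCycleLengthLaw μ L) (hunif : IsUniformAdmissible μ X L ρ) :
    IdentDistrib (fun ω => X ω ∘ ρ ω) X μ μ := by
  have hcomp : ∀ π : Equiv.Perm (Fin n), Measurable fun x : Fin n → ℝ => x ∘ π := fun π =>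
    measurable_pi_lambda _ fun a => measurable_pi_apply (π a)
  have hY : Measurable fun ω => X ω ∘ ρ ω := by
    intro A hA
    have : (fun ω => X ω ∘ ρ ω) ⁻¹' A =
        ⋃ σ, ρ ⁻¹' {σ} ∩ (fun ω => X ω ∘ σ) ⁻¹' A := by
      ext ω
      simp
    rw [this]
    exact MeasurableSet.iUnion fun σ => (hρ MeasurableSpace.measurableSet_top).inter
      (((hcomp σ).comp hX) hA)
  refine ⟨hY.aemeasurable, hX.aemeasurable, ?_⟩
  refine Measure.ext fun A hA => ?_
  rw [Measure.map_apply hY hA, Measure.map_apply hX hA, ← measureReal_eq_measureReal_iff]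
  have hE : ∀ σ, MeasurableSet {ω | ρ ω = σ} := fun σ =>
    hρ (MeasurableSpace.measurableSet_top (s := {σ}))
  have hS : ∀ σ : Equiv.Perm (Fin n), MeasurableSet {ω | X ω ∘ σ ∈ A} := fun σ =>
    ((hcomp σ).comp hX) hA
  have hsplit : (fun ω => X ω ∘ ρ ω) ⁻¹' A = ⋃ σ, {ω | ρ ω = σ} ∩ {ω | X ω ∘ σ ∈ A} := by
    ext ω
    simp
  have hterm : ∀ σ : Equiv.Perm (Fin n), μ.real ({ω | ρ ω = σ} ∩ {ω | X ω ∘ σ ∈ A}) =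
      ∑ p, cycleProb p *
        ∫ ω, (A.indicator 1 (X ω) : ℝ) * admissibleProb σ p (X ω ∘ σ.symm) ∂μ := by
    intro σ
    have h1 := measureReal_inter_eq_setIntegral hX hL hρ hunif σ
      (T := {z | z.1 ∘ σ ∈ A}) (((hcomp σ).comp measurable_fst) hA)
    simp only [Set.mem_ofPred_eq] at h1
    rw [h1, ← integral_indicator (hS σ)]
    have h2 := integral_indicator_mul_admissibleProb hX hL hexch hindep hA σ
    simp only [show ∀ p, μ.real {ω | L ω = p} = cycleProb p from hcycle] at h2
    rw [← h2]
    refine integral_congr_ae (Filter.Eventually.of_forall fun ω => ?_)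
    by_cases h : X ω ∘ σ ∈ A <;> simp [Set.indicator, h]
  have hint : ∀ (σ : Equiv.Perm (Fin n)) (p : Nat.Partition n), Integrable (fun ω =>
      (A.indicator 1 (X ω) : ℝ) * admissibleProb σ p (X ω ∘ σ.symm)) μ := by
    intro σ p
    refine Integrable.of_bound (C := 1) (Measurable.aestronglyMeasurable ?_)
      (Filter.Eventually.of_forall fun ω => ?_)
    · exact ((measurable_one.indicator hA).comp hX).mul
        ((measurable_admissibleProb p σ).comp ((hcomp σ.symm).comp hX))
    · rw [norm_mul]
      refine mul_le_one₀ ?_ (norm_nonneg _) ?_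
      · by_cases h : X ω ∈ A <;> simp [h]
      · rw [Real.norm_of_nonneg (admissibleProb_nonneg p σ _)]
        exact admissibleProb_le_one p σ _
  rw [hsplit, measureReal_iUnion_fintype]
  · simp_rw [hterm]
    rw [Finset.sum_comm]
    simp_rw [← Finset.mul_sum, ← integral_finsetSum Finset.univ fun σ _ => hint σ _,
      ← integral_const_mul]
    rw [← integral_finsetSum Finset.univ fun p _ =>
      (integrable_finsetSum Finset.univ fun σ _ => hint σ p).const_mul _,
      ← integral_indicator_one (hX hA)]
    refine integral_congr_ae (Filter.Eventually.of_forall fun ω => ?_)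
    -- The weights multiplying the indicator of `A` sum to 1 pointwise in `ω`, leaving the
    -- probability that `X ∈ A`.
    have h := sum_cycleProb_mul_sum_admissible (X ω)
    change ∑ p, cycleProb p * ∑ σ : Equiv.Perm (Fin n), admissibleProb σ p (X ω ∘ σ.symm) = 1 at h
    simp only [← Finset.mul_sum, mul_left_comm (cycleProb _), h, mul_one]
    rfl
  · intro σ σ' hne
    refine Set.disjoint_left.2 fun ω h h' => hne ?_
    exact h.1.symm.trans h'.1
  · exact fun σ => (hE σ).inter (hS σ)

end Law

end CyclicRearrangement

open CyclicRearrangement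
theorem theorem1 (n : ℕ) :
    (∀ (p : Nat.Partition n) (x : Fin n → ℝ), (admissible p x).Nonempty) ∧
    ∀ {Ω : Type*} [MeasurableSpace Ω] (μ : Measure Ω) [IsProbabilityMeasure μ]
      (X : Ω → Fin n → ℝ) (L : Ω → Nat.Partition n) (ρ : Ω → Equiv.Perm (Fin n)),
      Measurable X → Measurable L → Measurable ρ →
      Exchangeable μ X →
      IndepFun X L μ →
      HasCycleLengthLaw μ L →
      IsUniformAdmissible μ X L ρ →
      IdentDistrib (fun ω (j : Fin (n + 1)) => walk (X ω ∘ ρ ω) j)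
        (fun ω (j : Fin (n + 1)) => walk (X ω) j) μ μ ∧
      ∀ᵐ ω ∂μ, ∃ τ, IsAdmissible (L ω) (X ω) τ (ρ ω) ∧
        ∃ C : ℝ → ℝ, IsConcaveMajorant n (walk (X ω ∘ ρ ω)) C ∧
          ∀ i, ∀ t ∈ Set.Icc (start (L ω) τ i : ℝ) (start (L ω) τ i + blockLen (L ω) (τ i)),
            C t = walk (X ω ∘ ρ ω) (start (L ω) τ i) + (t - start (L ω) τ i) *
              segMean (X ω ∘ ρ ω) (start (L ω) τ i) (blockLen (L ω) (τ i)) := by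
  refine ⟨admissible_nonempty, ?_⟩
  intro Ω _ μ _ X L ρ hX hL hρ hexch hindep hcycle hunif
  constructor
  · exact (identDistrib_comp_rearrangement hX hL hρ hexch hindep hcycle hunif).comp
      (u := fun (x : Fin n → ℝ) (j : Fin (n + 1)) => walk x j)
      (measurable_pi_lambda _ fun j => measurable_walk j)
  · filter_upwards [ae_mem_admissible hX hL hρ hunif] with ω hω
    obtain ⟨τ, hτ⟩ := mem_admissible.1 hω
    exact ⟨τ, hτ, exists_isConcaveMajorant (L ω) hτ.2.1 hτ.2.2⟩
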